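/- Let $I=[0,1]$ and let $t_1:=1$, $t_{2q}(x):=\sqrt2\cos(2\pi qx)$, $t_{2q+1}(x):=\sqrt2\sin(2\pi qx)$ ($q\ge1$) be the trigonometric basis; let $\varphi_j$ be $t_j$ on $I$, extended by $0$ to $\mathbb R$. One observes $(X_i,Y_i)_{1\le i\le n}$ with $Y_i=b(X_i)+\varepsilon_i$, where $X_1,\dots,X_n$ are i.i.d. real random variables with density $f$, and $\varepsilon_1,\dots,\varepsilon_n$ are i.i.d., centred, with variance $\sigma^2$, and independent of the $X_i$'s. For an odd integer $m\ge1$ put $$\widehat\Phi_m:=(\varphi_j(X_i))_{i\le n,\,j\le m},\qquad \widehat\Psi_m:=\tfrac1n\widehat\Phi_m^*\widehat\Phi_m,\qquad \mathbf Y:=(Y_1,\dots,Y_n)^*,$$ let $\Delta_{m,m}$ be the $m\times m$ matrix with $t_j'=\sum_{k=1}^m[\Delta_{m,m}]_{j,k}t_k$ for $1\le j\le m$, and let $$\widehat b_m^{\prime,2}:=\sum_{j=1}^m[\widehat\theta_m^2]_j\,\varphi_j,\qquad \widehat\theta_m^2:=-\tfrac1n\Delta_{m,m}\widehat\Psi_m^{-1}\widehat\Phi_m^*\mathbf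 Y,\qquad \widetilde b_m^{\prime,2}:=\widehat b_m^{\prime,2}\,\mathbf 1_{\Lambda_m},$$ where $\Lambda_m$ is the event that $\widehat\Psi_m$ is invertible and $\mathfrak L(m)\,(\|\widehat\Psi_m^{-1}\|_{\rm op}\vee1)\le\mathfrak c\,n/\log n$, with $\mathfrak L(m):=\sup_{x\in I}\sum_{j\le m}\varphi_j(x)^2$ and $\mathfrak c:=(3\log(3/2)-1)/9$ (and $n/\log n:=+\infty$ for $n=1$). For an integer $\beta\ge1$ and $L>0$ let $$W^{\rm per}(\beta,L):=\Big\{g\in C^\beta([0,1];\mathbb R): g^{(\beta-1)}\text{ is absolutely continuous},\ \int_0^1 g^{(\beta)}(x)^2dx\le L^2,\ g^{(j)}(0)=g^{(j)}(1)\ \text{for } 0\le j\le\beta-1\Big\}.$$ **Corollary.** Let $\beta>1$ be an integer, $L>0$, $0<f_0$, $f_1<\infty$ and $\sigma\ge0$. There is a constant $C>0$, depending only on $L,\beta,f_1,f_0,\sigma^2$, such that the following holds for every $n\ge1$. If $f_0\le f(x)\le f_1$ for all $x\in[0,1]$, $b|_{[0,1]}\in W^{\rm per}(\beta,L)$ (in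 particular $b(0)=b(1)$), $\mathbb E[(b'\mathbf 1_I)(X_1)^4]<\infty$ and $\mathbb E(Y_1^4)<\infty$, then for every odd integer $m\ge1$ with $|m-n^{1/(2\beta+1)}|<2$ (that is, for $m_{\rm opt}=n^{1/(2\beta+1)}$ rounded up or down to an odd integer) $$\mathbb E\Big[\frac1n\sum_{i=1}^n\mathbf 1_{[0,1]}(X_i)\big(\widetilde b_m^{\prime,2}(X_i)-b'(X_i)\big)^2\Big]\le C\,n^{-2(\beta-1)/(2\beta+1)},$$ the expectation being finite. -/

import Mathlib

open MeasureTheory ProbabilityTheory Set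
open scoped Matrix

noncomputable section

namespace DerivReg

/-- The trigonometric functions, with indices starting at `1`:
`t₁ = 1`, `t_{2q}(x) = √2 cos(2πqx)`, `t_{2q+1}(x) = √2 sin(2πqx)` for `q ≥ 1`.
(The index `0` is never used.) -/
def trig (k : ℕ) (x : ℝ) : ℝ :=
  if k = 1 then 1
  else if Even k then √2 * Real.cos (2 * Real.pi * ((k / 2 : ℕ) : ℝ) * x)
  else √2 * Real.sin (2 * Real.pi * ((k / 2 : ℕ) : ℝ) * x)

/-- The basis function `φ_k`: the function `t_k` on `I = [0,1]`, extended by zero to `ℝ`. -/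
def phi (k : ℕ) : ℝ → ℝ := (Icc (0 : ℝ) 1).indicator (trig k)

/-- The coefficient of `t_k` in the expansion of the derivative of `t_j` (indices from `1`):
`t_{2q}' = -2πq t_{2q+1}`, `t_{2q+1}' = 2πq t_{2q}`, `t₁' = 0`. -/
def derivCoeff (j k : ℕ) : ℝ :=
  if Even j then (if k = j + 1 then -(2 * Real.pi * ((j / 2 : ℕ) : ℝ)) else 0)
  else (if k + 1 = j then 2 * Real.pi * ((j / 2 : ℕ) : ℝ) else 0)

/-- The square matrix `Δ_{m,m}` of the derivation on `span (t₁, …, t_m)`, for odd `m`. -/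
def derivMatrix (m : ℕ) : Matrix (Fin m) (Fin m) ℝ :=
  Matrix.of fun j k => derivCoeff (j + 1) (k + 1)

/-- The matrix `Δ_{m,m}` is the one it should be: for odd `m`, and every `j`,
`t_j' = ∑ₖ Δ(j,k) t_k`. -/
theorem hasDerivAt_trig {m : ℕ} (hm : Odd m) (j : Fin m) (x : ℝ) :
    HasDerivAt (trig (j + 1)) (∑ k : Fin m, derivMatrix m j k * trig (k + 1) x) x := by
  obtain ⟨j, hj⟩ := j
  have hsum : (∑ k : Fin m, derivMatrix m ⟨j, hj⟩ k * trig (k + 1) x)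
      = ∑ k ∈ Finset.range m, derivCoeff (j + 1) (k + 1) * trig (k + 1) x :=
    Fin.sum_univ_eq_sum_range (fun k => derivCoeff (j + 1) (k + 1) * trig (k + 1) x) m
  rw [hsum]
  rcases Nat.even_or_odd' (j + 1) with ⟨q, hq | hq⟩
  · have hlt : j + 1 < m := by
      obtain ⟨r, hr⟩ := hm
      omega
    rw [Finset.sum_eq_single (j + 1)]
    · have h1 : trig (j + 1) = fun y => √2 * Real.cos (2 * Real.pi * (q : ℝ) * y) := by
        funext y
        have : (j + 1) / 2 = q := by omega
        have h2 : j + 1 ≠ 1 := by omega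
        have h3 : Even (j + 1) := ⟨q, by omega⟩
        simp only [trig, if_neg h2, if_pos h3, this]
      have h2 : trig (j + 1 + 1) x = √2 * Real.sin (2 * Real.pi * (q : ℝ) * x) := by
        have : (j + 1 + 1) / 2 = q := by omega
        have h2 : j + 1 + 1 ≠ 1 := by omega
        have h3 : ¬ Even (j + 1 + 1) := by
          rintro ⟨r, hr⟩
          omega
        simp only [trig, if_neg h2, if_neg h3, this]
      have h3 : derivCoeff (j + 1) (j + 1 + 1) = -(2 * Real.pi * (q : ℝ)) := by
        have : (j + 1) / 2 = q := by omega
        have h3 : Even (j + 1) := ⟨q, by omega⟩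
        simp only [derivCoeff, if_pos h3, this, if_true]
      rw [h1, h2, h3]
      have h4 := (((hasDerivAt_id x).const_mul (2 * Real.pi * (q : ℝ))).cos).const_mul √2
      refine h4.congr_deriv ?_
      simp only [id]
      ring
    · intro k _ hk
      have h3 : Even (j + 1) := ⟨q, by omega⟩
      have h4 : ¬ (k + 1 = j + 1 + 1) := by omega
      simp only [derivCoeff, if_pos h3, if_neg h4, zero_mul]
    · intro h
      exact absurd (Finset.mem_range.2 hlt) h
  · have h3 : ¬ Even (j + 1) := by
      rintro ⟨r, hr⟩
      omega
    rcases Nat.eq_zero_or_pos q with h0 | h0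
    · have hj0 : j = 0 := by omega
      subst hj0
      have h1 : trig (0 + 1) = fun _ => (1 : ℝ) := by
        funext y
        simp [trig]
      rw [h1, Finset.sum_eq_zero]
      · exact hasDerivAt_const x 1
      · intro k _
        simp [derivCoeff]
    · rw [Finset.sum_eq_single (j - 1)]
      · have h1 : trig (j + 1) = fun y => √2 * Real.sin (2 * Real.pi * (q : ℝ) * y) := by
          funext y
          have : (j + 1) / 2 = q := by omega
          have h2 : j + 1 ≠ 1 := by omega
          simp only [trig, if_neg h2, if_neg h3, this]
        have h2 : trig (j - 1 + 1) x = √2 * Real.cos (2 * Real.pi * (q : ℝ) * x) := by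
          have : (j - 1 + 1) / 2 = q := by omega
          have h2 : j - 1 + 1 ≠ 1 := by omega
          have h3 : Even (j - 1 + 1) := ⟨q, by omega⟩
          simp only [trig, if_neg h2, if_pos h3, this]
        have h5 : derivCoeff (j + 1) (j - 1 + 1) = 2 * Real.pi * (q : ℝ) := by
          have : (j + 1) / 2 = q := by omega
          have h6 : j - 1 + 1 + 1 = j + 1 := by omega
          simp only [derivCoeff, if_neg h3, if_pos h6, this]
        rw [h1, h2, h5]
        have h4 := (((hasDerivAt_id x).const_mul (2 * Real.pi * (q : ℝ))).sin).const_mul √2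
        refine h4.congr_deriv ?_
        simp only [id]
        ring
      · intro k _ hk
        have h4 : ¬ (k + 1 + 1 = j + 1) := by omega
        simp only [derivCoeff, if_neg h3, if_neg h4, zero_mul]
      · intro h
        exact absurd (Finset.mem_range.2 (by omega)) h

variable {n : ℕ}

/-- The design matrix `Φ̂_m = (φ_j(X_i))_{i,j}`. -/
def designMatrix (m : ℕ) (x : Fin n → ℝ) : Matrix (Fin n) (Fin m) ℝ :=
  Matrix.of fun i j => phi (j + 1) (x i)

/-- The empirical Gram matrix `Ψ̂_m = n⁻¹ Φ̂_mᵀ Φ̂_m`. -/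
def empGram (m : ℕ) (x : Fin n → ℝ) : Matrix (Fin m) (Fin m) ℝ :=
  (1 / (n : ℝ)) • ((designMatrix m x)ᵀ * designMatrix m x)

/-- The coefficients `θ̂²_m = - n⁻¹ Δ_{m,m} Ψ̂_m⁻¹ Φ̂_mᵀ Y`. -/
def coeff (m : ℕ) (x y : Fin n → ℝ) : Fin m → ℝ :=
  -((1 / (n : ℝ)) • (derivMatrix m *ᵥ ((empGram m x)⁻¹ *ᵥ ((designMatrix m x)ᵀ *ᵥ y))))

/-- The projection estimator `b̂'^{,2}_m` of the derivative. -/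
def estimator (m : ℕ) (x y : Fin n → ℝ) (t : ℝ) : ℝ :=
  ∑ j : Fin m, coeff m x y j * phi (j + 1) t

/-- `𝔏(m) = sup_{t ∈ [0,1]} ∑_{j ≤ m} φ_j(t)²`. -/
def supSq (m : ℕ) : ℝ := ⨆ t : Icc (0 : ℝ) 1, ∑ j : Fin m, phi (j + 1) (t : ℝ) ^ 2

/-- The numerical constant `𝔠 = (3 log(3/2) - 1) / 9`. -/
def cutoffConst : ℝ := (3 * Real.log (3 / 2) - 1) / 9

/-- The operator (spectral) norm of a square matrix. -/
def opNorm {m : ℕ} (A : Matrix (Fin m) (Fin m) ℝ) : ℝ :=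
  ‖Matrix.toEuclideanCLM (𝕜 := ℝ) A‖

/-- The truncation event `Λ_m`: the matrix `Ψ̂_m` is invertible and
`𝔏(m) (‖Ψ̂_m⁻¹‖ ∨ 1) ≤ 𝔠 n / log n`. The denominator is cleared, so that the bound is void
(`n / log n = +∞`) for `n = 1`. -/
def Stable (m : ℕ) (x : Fin n → ℝ) : Prop :=
  IsUnit (empGram m x) ∧
    supSq m * max (opNorm (empGram m x)⁻¹) 1 * Real.log n ≤ cutoffConst * n

open Classical in
/-- The truncated estimator `b̃'^{,2}_m`. -/
def truncEstimator (m : ℕ) (x y : Fin n → ℝ) (t : ℝ) : ℝ :=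
  if Stable m x then estimator m x y t else 0

/-- The squared empirical norm `‖g‖_n²` of a function `g` on `[0,1]` (extended by zero). -/
def empNormSq (x : Fin n → ℝ) (g : ℝ → ℝ) : ℝ :=
  (1 / (n : ℝ)) * ∑ i, ((Icc (0 : ℝ) 1).indicator g (x i)) ^ 2

/-- The periodic Sobolev class `W^per(β, L)` (only the values of `g` on `[0,1]` matter). -/
def PerSobolev (β : ℕ) (L : ℝ) : Set (ℝ → ℝ) :=
  {g | ContDiffOn ℝ β g (Icc 0 1) ∧
    AbsolutelyContinuousOnInterval (iteratedDerivWithin (β - 1) g (Icc 0 1)) 0 1 ∧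
    ∫ x in (0 : ℝ)..1, (iteratedDerivWithin β g (Icc 0 1) x) ^ 2 ≤ L ^ 2 ∧
    ∀ j < β, iteratedDerivWithin j g (Icc 0 1) 0 = iteratedDerivWithin j g (Icc 0 1) 1}

end DerivReg

end

noncomputable section

namespace DerivReg

theorem trig_even {k q : ℕ} (hk : k = 2 * q) :
    trig k = fun x => √2 * Real.cos (2 * Real.pi * (q : ℝ) * x) := by
  funext x
  have h1 : k ≠ 1 := by omega
  have h2 : Even k := ⟨q, by omega⟩
  have h3 : k / 2 = q := by omega
  simp only [trig, if_neg h1, if_pos h2, h3]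

theorem trig_odd {k q : ℕ} (hk : k = 2 * q + 1) (hq : 1 ≤ q) :
    trig k = fun x => √2 * Real.sin (2 * Real.pi * (q : ℝ) * x) := by
  funext x
  have h1 : k ≠ 1 := by omega
  have h2 : ¬ Even k := by
    rintro ⟨r, hr⟩
    omega
  have h3 : k / 2 = q := by omega
  simp only [trig, if_neg h1, if_neg h2, h3]

theorem trig_one : trig 1 = fun _ => (1 : ℝ) := by
  funext x
  simp [trig]

theorem trig_cases (k : ℕ) (hk : 1 ≤ k) :
    k = 1 ∨ ∃ q : ℕ, 1 ≤ q ∧ (k = 2 * q ∨ k = 2 * q + 1) := by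
  by_cases h : k = 1
  · exact Or.inl h
  · exact Or.inr ⟨k / 2, by omega, by omega⟩

theorem continuous_trig (k : ℕ) : Continuous (trig k) := by
  unfold trig
  split_ifs <;> fun_prop

theorem trig_sq_le (k : ℕ) (x : ℝ) : trig k x ^ 2 ≤ 2 := by
  unfold trig
  split_ifs
  · norm_num
  · rw [mul_pow, Real.sq_sqrt (by norm_num)]
    nlinarith [Real.cos_sq_le_one (2 * Real.pi * ((k / 2 : ℕ) : ℝ) * x)]
  · rw [mul_pow, Real.sq_sqrt (by norm_num)]
    nlinarith [Real.sin_sq_le_one (2 * Real.pi * ((k / 2 : ℕ) : ℝ) * x)]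

theorem trig_zero_eq_trig_one (k : ℕ) : trig k 0 = trig k 1 := by
  unfold trig
  generalize k / 2 = q
  have h1 : Real.cos (2 * Real.pi * (q : ℝ) * 1) = 1 := by
    rw [Real.cos_eq_one_iff]
    exact ⟨(q : ℤ), by push_cast; ring⟩
  have h2 : Real.sin (2 * Real.pi * (q : ℝ) * 1) = 0 := by
    rw [Real.sin_eq_zero_iff]
    exact ⟨2 * (q : ℤ), by push_cast; ring⟩
  rw [h1, h2]
  simp

theorem integral_cos_two_pi_int {p : ℤ} (hp : p ≠ 0) :
    ∫ x in (0 : ℝ)..1, Real.cos (2 * Real.pi * (p : ℝ) * x) = 0 := by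
  have hc : 2 * Real.pi * (p : ℝ) ≠ 0 := by
    have : (p : ℝ) ≠ 0 := by exact_mod_cast hp
    positivity
  rw [intervalIntegral.integral_comp_mul_left (fun x => Real.cos x) hc, integral_cos]
  have h : Real.sin (2 * Real.pi * (p : ℝ) * 1) = 0 := by
    rw [Real.sin_eq_zero_iff]
    exact ⟨2 * p, by push_cast; ring⟩
  rw [h]
  simp

theorem integral_sin_two_pi_int (p : ℤ) :
    ∫ x in (0 : ℝ)..1, Real.sin (2 * Real.pi * (p : ℝ) * x) = 0 := by
  by_cases hp : p = 0
  · simp [hp]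
  have hc : 2 * Real.pi * (p : ℝ) ≠ 0 := by
    have : (p : ℝ) ≠ 0 := by exact_mod_cast hp
    positivity
  rw [intervalIntegral.integral_comp_mul_left (fun x => Real.sin x) hc, integral_sin]
  have h : Real.cos (2 * Real.pi * (p : ℝ) * 1) = 1 := by
    rw [Real.cos_eq_one_iff]
    exact ⟨p, by ring⟩
  rw [h]
  simp

theorem integral_cos_add_cos (p q : ℤ) :
    ∫ x in (0 : ℝ)..1, (Real.cos (2 * Real.pi * (p : ℝ) * x) + Real.cos (2 * Real.pi * (q : ℝ) * x))
      = (if p = 0 then 1 else 0) + (if q = 0 then 1 else 0) := by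
  have h : ∀ p : ℤ, ∫ x in (0 : ℝ)..1, Real.cos (2 * Real.pi * (p : ℝ) * x)
      = if p = 0 then 1 else 0 := by
    intro p
    split_ifs with h
    · simp [h]
    · exact integral_cos_two_pi_int h
  rw [intervalIntegral.integral_add, h, h]
  · exact Continuous.intervalIntegrable (by fun_prop) _ _
  · exact Continuous.intervalIntegrable (by fun_prop) _ _

theorem integral_sin_add_sin (p q : ℤ) :
    ∫ x in (0 : ℝ)..1, (Real.sin (2 * Real.pi * (p : ℝ) * x) + Real.sin (2 * Real.pi * (q : ℝ) * x))
      = 0 := by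
  rw [intervalIntegral.integral_add, integral_sin_two_pi_int, integral_sin_two_pi_int, add_zero]
  · exact Continuous.intervalIntegrable (by fun_prop) _ _
  · exact Continuous.intervalIntegrable (by fun_prop) _ _

/-- The trigonometric functions are orthonormal in `L²([0,1])`. -/
theorem integral_trig_mul_trig {j k : ℕ} (hj : 1 ≤ j) (hk : 1 ≤ k) :
    ∫ x in (0 : ℝ)..1, trig j x * trig k x = if j = k then 1 else 0 := by
  have hs : √2 * √2 = (2 : ℝ) := Real.mul_self_sqrt (by norm_num)
  rcases trig_cases j hj with rfl | ⟨p, hp, rfl | rfl⟩ <;>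
  rcases trig_cases k hk with rfl | ⟨q, hq, rfl | rfl⟩
  · simp [trig_one]
  · rw [trig_one, trig_even rfl, if_neg (by omega)]
    simp only [one_mul, intervalIntegral.integral_const_mul]
    have := integral_cos_two_pi_int (p := (q : ℤ)) (by omega)
    rw [Int.cast_natCast] at this
    rw [this, mul_zero]
  · rw [trig_one, trig_odd rfl hq, if_neg (by omega)]
    simp only [one_mul, intervalIntegral.integral_const_mul]
    have := integral_sin_two_pi_int (q : ℤ)
    rw [Int.cast_natCast] at this
    rw [this, mul_zero]
  · rw [trig_one, trig_even rfl, if_neg (by omega)]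
    simp only [mul_one, intervalIntegral.integral_const_mul]
    have := integral_cos_two_pi_int (p := (p : ℤ)) (by omega)
    rw [Int.cast_natCast] at this
    rw [this, mul_zero]
  · rw [trig_even rfl, trig_even rfl]
    have h := integral_cos_add_cos ((p : ℤ) - q) (p + q)
    rw [if_neg (show ¬ ((p : ℤ) + q = 0) by omega)] at h
    trans ∫ x in (0 : ℝ)..1, (Real.cos (2 * Real.pi * (((p : ℤ) - q : ℤ) : ℝ) * x)
        + Real.cos (2 * Real.pi * (((p : ℤ) + q : ℤ) : ℝ) * x))
    · congr 1
      funext x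
      push_cast
      have e1 : 2 * Real.pi * ((p : ℝ) - q) * x = 2 * Real.pi * p * x - 2 * Real.pi * q * x := by
        ring
      have e2 : 2 * Real.pi * ((p : ℝ) + q) * x = 2 * Real.pi * p * x + 2 * Real.pi * q * x := by
        ring
      rw [e1, e2, Real.cos_sub, Real.cos_add, mul_mul_mul_comm, hs]
      ring
    · rw [h, add_zero]
      exact if_congr (by omega) rfl rfl
  · rw [trig_even rfl, trig_odd rfl hq, if_neg (by omega)]
    trans ∫ x in (0 : ℝ)..1, (Real.sin (2 * Real.pi * (((q : ℤ) - p : ℤ) : ℝ) * x)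
        + Real.sin (2 * Real.pi * (((p : ℤ) + q : ℤ) : ℝ) * x))
    · congr 1
      funext x
      push_cast
      have e1 : 2 * Real.pi * ((q : ℝ) - p) * x = 2 * Real.pi * q * x - 2 * Real.pi * p * x := by
        ring
      have e2 : 2 * Real.pi * ((p : ℝ) + q) * x = 2 * Real.pi * q * x + 2 * Real.pi * p * x := by
        ring
      rw [e1, e2, Real.sin_sub, Real.sin_add, mul_mul_mul_comm, hs]
      ring
    · exact integral_sin_add_sin _ _
  · rw [trig_one, trig_odd rfl hp, if_neg (by omega)]
    simp only [mul_one, intervalIntegral.integral_const_mul]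
    have := integral_sin_two_pi_int (p : ℤ)
    rw [Int.cast_natCast] at this
    rw [this, mul_zero]
  · rw [trig_even rfl, trig_odd rfl hp, if_neg (by omega)]
    trans ∫ x in (0 : ℝ)..1, (Real.sin (2 * Real.pi * (((p : ℤ) - q : ℤ) : ℝ) * x)
        + Real.sin (2 * Real.pi * (((p : ℤ) + q : ℤ) : ℝ) * x))
    · congr 1
      funext x
      push_cast
      have e1 : 2 * Real.pi * ((p : ℝ) - q) * x = 2 * Real.pi * p * x - 2 * Real.pi * q * x := by
        ring
      have e2 : 2 * Real.pi * ((p : ℝ) + q) * x = 2 * Real.pi * p * x + 2 * Real.pi * q * x := by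
        ring
      rw [e1, e2, Real.sin_sub, Real.sin_add, mul_mul_mul_comm, hs]
      ring
    · exact integral_sin_add_sin _ _
  · rw [trig_odd rfl hp, trig_odd rfl hq]
    have hn : (p : ℤ) + q ≠ 0 := by omega
    trans ∫ x in (0 : ℝ)..1, (Real.cos (2 * Real.pi * (((p : ℤ) - q : ℤ) : ℝ) * x)
        - Real.cos (2 * Real.pi * (((p : ℤ) + q : ℤ) : ℝ) * x))
    · congr 1
      funext x
      push_cast
      have e1 : 2 * Real.pi * ((p : ℝ) - q) * x = 2 * Real.pi * p * x - 2 * Real.pi * q * x := by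
        ring
      have e2 : 2 * Real.pi * ((p : ℝ) + q) * x = 2 * Real.pi * p * x + 2 * Real.pi * q * x := by
        ring
      rw [e1, e2, Real.cos_sub, Real.cos_add, mul_mul_mul_comm, hs]
      ring
    · rw [intervalIntegral.integral_sub, integral_cos_two_pi_int hn, sub_zero]
      · split_ifs with h
        · have : (p : ℤ) - q = 0 := by omega
          simp [this]
        · exact integral_cos_two_pi_int (by omega)
      · exact Continuous.intervalIntegrable (by fun_prop) _ _
      · exact Continuous.intervalIntegrable (by fun_prop) _ _

/-- The trigonometric polynomial `∑ⱼ aⱼ tⱼ`. -/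
def trigSum (m : ℕ) (a : Fin m → ℝ) (x : ℝ) : ℝ := ∑ j : Fin m, a j * trig (j + 1) x

theorem continuous_trigSum (m : ℕ) (a : Fin m → ℝ) : Continuous (trigSum m a) :=
  continuous_finsetSum _ fun j _ => continuous_const.mul (continuous_trig (j + 1))

theorem trigSum_zero_eq_trigSum_one (m : ℕ) (a : Fin m → ℝ) : trigSum m a 0 = trigSum m a 1 := by
  simp only [trigSum, trig_zero_eq_trig_one]

theorem hasDerivAt_trigSum {m : ℕ} (hm : Odd m) (a : Fin m → ℝ) (x : ℝ) :
    HasDerivAt (trigSum m a) (trigSum m ((derivMatrix m)ᵀ *ᵥ a) x) x := by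
  have h := HasDerivAt.fun_sum (u := Finset.univ)
    fun (j : Fin m) _ => (hasDerivAt_trig hm j x).const_mul (a j)
  refine h.congr_deriv ?_
  simp only [trigSum, Matrix.mulVec, dotProduct, Matrix.transpose_apply, Finset.sum_mul,
    Finset.mul_sum]
  rw [Finset.sum_comm]
  exact Finset.sum_congr rfl fun k _ => Finset.sum_congr rfl fun j _ => by ring

theorem integral_trigSum_mul_trig (m : ℕ) (a : Fin m → ℝ) (k : Fin m) :
    ∫ x in (0 : ℝ)..1, trigSum m a x * trig (k + 1) x = a k := by
  simp only [trigSum, Finset.sum_mul, mul_assoc]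
  rw [intervalIntegral.integral_finsetSum]
  · simp only [intervalIntegral.integral_const_mul]
    rw [Finset.sum_eq_single k]
    · rw [integral_trig_mul_trig (by omega) (by omega), if_pos rfl, mul_one]
    · intro j _ hj
      rw [integral_trig_mul_trig (by omega) (by omega), if_neg, mul_zero]
      intro h
      exact hj (Fin.ext (by omega))
    · simp
  · intro j _
    exact (continuous_const.mul ((continuous_trig _).mul (continuous_trig _))).intervalIntegrable _ _

theorem integral_mul_trigSum {m : ℕ} {h : ℝ → ℝ} (hh : ContinuousOn h (Icc 0 1)) (a : Fin m → ℝ) :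
    ∫ x in (0 : ℝ)..1, h x * trigSum m a x
      = ∑ j, a j * ∫ x in (0 : ℝ)..1, h x * trig (j + 1) x := by
  simp only [trigSum, Finset.mul_sum]
  rw [intervalIntegral.integral_finsetSum]
  · refine Finset.sum_congr rfl fun j _ => ?_
    rw [← intervalIntegral.integral_const_mul]
    congr 1
    funext x
    ring
  · intro j _
    refine ContinuousOn.intervalIntegrable ?_
    rw [uIcc_of_le zero_le_one]
    exact hh.mul (continuous_const.mul (continuous_trig _)).continuousOn

theorem integral_trigSum_sq (m : ℕ) (a : Fin m → ℝ) :
    ∫ x in (0 : ℝ)..1, trigSum m a x ^ 2 = ∑ j, a j ^ 2 := by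
  simp only [sq]
  rw [integral_mul_trigSum (continuous_trigSum m a).continuousOn]
  simp only [integral_trigSum_mul_trig]

/-- `h` is orthogonal in `L²([0,1])` to the first `m` trigonometric functions. -/
def TrigOrth (m : ℕ) (h : ℝ → ℝ) : Prop :=
  ∀ j : Fin m, ∫ x in (0 : ℝ)..1, h x * trig (j + 1) x = 0

theorem trigOrth_sub_projection {m : ℕ} {g : ℝ → ℝ} (hg : ContinuousOn g (Icc 0 1)) :
    TrigOrth m (fun x => g x
      - trigSum m (fun j => ∫ x in (0 : ℝ)..1, g x * trig (j + 1) x) x) := by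
  intro k
  simp only [sub_mul]
  rw [intervalIntegral.integral_sub, integral_trigSum_mul_trig, sub_self]
  · refine ContinuousOn.intervalIntegrable ?_
    rw [uIcc_of_le zero_le_one]
    exact hg.mul (continuous_trig _).continuousOn
  · exact ((continuous_trigSum _ _).mul (continuous_trig _)).intervalIntegrable _ _

theorem TrigOrth.integral_sq_le {m : ℕ} {g : ℝ → ℝ} (hg : ContinuousOn g (Icc 0 1))
    {a : Fin m → ℝ} (ho : TrigOrth m fun x => g x - trigSum m a x) :
    ∫ x in (0 : ℝ)..1, (g x - trigSum m a x) ^ 2 ≤ ∫ x in (0 : ℝ)..1, g x ^ 2 := by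
  have hc : ContinuousOn (fun x => g x - trigSum m a x) (Icc 0 1) :=
    hg.sub (continuous_trigSum m a).continuousOn
  have h1 : ∫ x in (0 : ℝ)..1, (g x - trigSum m a x) * trigSum m a x = 0 := by
    rw [integral_mul_trigSum hc]
    exact Finset.sum_eq_zero fun j _ => by rw [ho j, mul_zero]
  have h2 : ∫ x in (0 : ℝ)..1, ((g x - trigSum m a x) ^ 2
      + 2 * ((g x - trigSum m a x) * trigSum m a x)) ≤ ∫ x in (0 : ℝ)..1, g x ^ 2 := by
    refine intervalIntegral.integral_mono_on zero_le_one ?_ ?_ fun x _ => ?_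
    · refine ContinuousOn.intervalIntegrable ?_
      rw [uIcc_of_le zero_le_one]
      exact (hc.pow 2).add (continuousOn_const.mul (hc.mul (continuous_trigSum m a).continuousOn))
    · refine ContinuousOn.intervalIntegrable ?_
      rw [uIcc_of_le zero_le_one]
      exact hg.pow 2
    · nlinarith [sq_nonneg (trigSum m a x)]
  rw [intervalIntegral.integral_add, intervalIntegral.integral_const_mul, h1, mul_zero,
    add_zero] at h2
  · exact h2
  · refine ContinuousOn.intervalIntegrable ?_
    rw [uIcc_of_le zero_le_one]
    exact hc.pow 2
  · refine ContinuousOn.intervalIntegrable ?_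
    rw [uIcc_of_le zero_le_one]
    exact continuousOn_const.mul (hc.mul (continuous_trigSum m a).continuousOn)

theorem intervalIntegrable_of_continuousOn_Icc {g : ℝ → ℝ} (hg : ContinuousOn g (Icc 0 1)) :
    IntervalIntegrable g volume 0 1 := by
  refine ContinuousOn.intervalIntegrable ?_
  rwa [uIcc_of_le zero_le_one]

theorem intervalIntegrable_ofReal {g : ℝ → ℝ} (hg : ContinuousOn g (Icc 0 1)) :
    IntervalIntegrable (fun x => (g x : ℂ)) volume 0 1 := by
  refine ContinuousOn.intervalIntegrable ?_
  rw [uIcc_of_le zero_le_one]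
  exact Complex.continuous_ofReal.comp_continuousOn hg

theorem TrigOrth.integral_mul_cos_eq_zero {m : ℕ} {h : ℝ → ℝ} (ho : TrigOrth m h) {p : ℕ}
    (hp : 2 * p ≤ m) (hm : 1 ≤ m) :
    ∫ x in (0 : ℝ)..1, h x * Real.cos (2 * Real.pi * (p : ℝ) * x) = 0 := by
  rcases Nat.eq_zero_or_pos p with rfl | hp0
  · have := ho ⟨0, by omega⟩
    simpa [trig_one] using this
  · have := ho ⟨2 * p - 1, by omega⟩
    simp only [show 2 * p - 1 + 1 = 2 * p by omega, trig_even rfl] at this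
    simp only [mul_left_comm _ (√2), intervalIntegral.integral_const_mul] at this
    exact (mul_eq_zero.1 this).resolve_left (by positivity)

theorem TrigOrth.integral_mul_sin_eq_zero {m : ℕ} {h : ℝ → ℝ} (ho : TrigOrth m h) {p : ℕ}
    (hp : 2 * p + 1 ≤ m) :
    ∫ x in (0 : ℝ)..1, h x * Real.sin (2 * Real.pi * (p : ℝ) * x) = 0 := by
  rcases Nat.eq_zero_or_pos p with rfl | hp0
  · simp
  · have := ho ⟨2 * p, by omega⟩
    simp only [trig_odd rfl hp0] at this
    simp only [mul_left_comm _ (√2), intervalIntegral.integral_const_mul] at this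
    exact (mul_eq_zero.1 this).resolve_left (by positivity)

theorem TrigOrth.fourierCoeffOn_eq_zero {m : ℕ} {h : ℝ → ℝ} (hh : ContinuousOn h (Icc 0 1))
    (ho : TrigOrth m h) {i : ℤ} (hi : 2 * i.natAbs + 1 ≤ m) :
    fourierCoeffOn (zero_lt_one' ℝ) (fun x => (h x : ℂ)) i = 0 := by
  rw [fourierCoeffOn_eq_integral]
  have hc : ∫ x in (0 : ℝ)..1, h x * Real.cos (2 * Real.pi * (i : ℝ) * x) = 0 := by
    have := ho.integral_mul_cos_eq_zero (p := i.natAbs) (by omega) (by omega)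
    rcases Int.natAbs_eq i with h | h
    · rw [h]
      simpa using this
    · rw [h]
      simpa using this
  have hs : ∫ x in (0 : ℝ)..1, h x * Real.sin (2 * Real.pi * (i : ℝ) * x) = 0 := by
    have := ho.integral_mul_sin_eq_zero (p := i.natAbs) (by omega)
    rcases Int.natAbs_eq i with h | h
    · rw [h]
      simpa using this
    · rw [h]
      simpa using this
  have key : ∀ x : ℝ, (fourier (-i) (x : AddCircle ((1 : ℝ) - 0)) : ℂ) • (h x : ℂ)
      = ((h x * Real.cos (2 * Real.pi * (i : ℝ) * x) : ℝ) : ℂ)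
        - Complex.I * ((h x * Real.sin (2 * Real.pi * (i : ℝ) * x) : ℝ) : ℂ) := by
    intro x
    rw [fourier_coe_apply]
    have : 2 * (Real.pi : ℂ) * Complex.I * ((-i : ℤ) : ℂ) * (x : ℂ) / (((1 : ℝ) - 0 : ℝ) : ℂ)
        = ((-(2 * Real.pi * (i : ℝ) * x) : ℝ) : ℂ) * Complex.I := by
      push_cast
      ring
    rw [this, Complex.exp_mul_I, ← Complex.ofReal_cos, ← Complex.ofReal_sin, Real.cos_neg,
      Real.sin_neg, smul_eq_mul]
    push_cast
    ring
  simp only [key]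
  rw [intervalIntegral.integral_sub, intervalIntegral.integral_const_mul,
    intervalIntegral.integral_ofReal, intervalIntegral.integral_ofReal, hc, hs]
  · simp
  · have hc' : ContinuousOn (fun x => h x * Real.cos (2 * Real.pi * (i : ℝ) * x)) (Icc 0 1) :=
      hh.mul (by fun_prop)
    exact intervalIntegrable_ofReal hc'
  · have hs' : ContinuousOn (fun x => h x * Real.sin (2 * Real.pi * (i : ℝ) * x)) (Icc 0 1) :=
      hh.mul (by fun_prop)
    exact (intervalIntegrable_ofReal hs').const_mul _

theorem hasSum_sq_fourierCoeffOn_ofReal {h : ℝ → ℝ} (hh : ContinuousOn h (Icc 0 1)) :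
    HasSum (fun i : ℤ => ‖fourierCoeffOn (zero_lt_one' ℝ) (fun x => (h x : ℂ)) i‖ ^ 2)
      (∫ x in (0 : ℝ)..1, h x ^ 2) := by
  have hc : ContinuousOn (fun x => (h x : ℂ)) (Icc 0 1) :=
    Complex.continuous_ofReal.comp_continuousOn hh
  obtain ⟨C, hC⟩ := isCompact_Icc.exists_bound_of_continuousOn hc
  have hL : MemLp (fun x => (h x : ℂ)) 2 (volume.restrict (Ioc (0 : ℝ) 1)) := by
    refine MemLp.of_bound ((hc.mono Ioc_subset_Icc_self).aestronglyMeasurable measurableSet_Ioc)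
      C ?_
    exact (ae_restrict_iff' measurableSet_Ioc).2
      (Filter.Eventually.of_forall fun x hx => hC x (Ioc_subset_Icc_self hx))
  simpa using hasSum_sq_fourierCoeffOn (zero_lt_one' ℝ) hL

/-- **Wirtinger's inequality** for periodic functions without low frequencies. -/
theorem TrigOrth.wirtinger {m : ℕ} (hm : Odd m) {h h' : ℝ → ℝ} (hh : ContinuousOn h (Icc 0 1))
    (hh' : ContinuousOn h' (Icc 0 1)) (hd : ∀ x ∈ Ioo (0 : ℝ) 1, HasDerivAt h (h' x) x)
    (hper : h 0 = h 1) (ho : TrigOrth m h) :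
    (m : ℝ) ^ 2 * ∫ x in (0 : ℝ)..1, h x ^ 2 ≤ ∫ x in (0 : ℝ)..1, h' x ^ 2 := by
  refine hasSum_le (fun i => ?_) ((hasSum_sq_fourierCoeffOn_ofReal hh).mul_left ((m : ℝ) ^ 2))
    (hasSum_sq_fourierCoeffOn_ofReal hh')
  by_cases hi : 2 * i.natAbs + 1 ≤ m
  · rw [ho.fourierCoeffOn_eq_zero hh hi]
    simp only [norm_zero, ne_eq, OfNat.ofNat_ne_zero, not_false_eq_true, zero_pow, mul_zero]
    positivity
  have hi0 : i ≠ 0 := by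
    rintro rfl
    obtain ⟨r, hr⟩ := hm
    simp at hi
    omega
  have h1 := fourierCoeffOn_of_hasDerivAt_Ioo (zero_lt_one' ℝ) (f := fun x => (h x : ℂ))
    (f' := fun x => (h' x : ℂ)) hi0
    (by
      rw [uIcc_of_le zero_le_one]
      exact Complex.continuous_ofReal.comp_continuousOn hh)
    (by
      intro x hx
      rw [min_eq_left zero_le_one, max_eq_right zero_le_one] at hx
      exact (hd x hx).ofReal_comp)
    (intervalIntegrable_ofReal hh')
  rw [hper, sub_self, mul_zero] at h1
  have h2 : ‖fourierCoeffOn (zero_lt_one' ℝ) (fun x => (h' x : ℂ)) i‖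
      = 2 * Real.pi * (i.natAbs : ℝ) * ‖fourierCoeffOn (zero_lt_one' ℝ) (fun x => (h x : ℂ)) i‖ := by
    rw [h1]
    have hn : ‖(i : ℂ)‖ = (i.natAbs : ℝ) := by
      rw [Complex.norm_intCast, Nat.cast_natAbs, Int.cast_abs]
    simp only [Complex.ofReal_one, Complex.ofReal_zero, sub_zero, one_mul, zero_sub, norm_mul, norm_neg, norm_div, norm_one,
      Complex.norm_I, hn, Complex.norm_real, Real.norm_eq_abs, abs_of_pos Real.pi_pos,
      Complex.norm_ofNat, mul_one]
    have : (i.natAbs : ℝ) ≠ 0 := by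
      exact_mod_cast Int.natAbs_ne_zero.2 hi0
    have := Real.pi_ne_zero
    field_simp
  rw [h2, mul_pow]
  have h3 : (m : ℝ) ≤ 2 * (i.natAbs : ℝ) := by
    exact_mod_cast (show m ≤ 2 * i.natAbs by omega)
  have h4 : (m : ℝ) ≤ 2 * Real.pi * (i.natAbs : ℝ) := by
    nlinarith [Real.pi_gt_three, Nat.cast_nonneg (α := ℝ) i.natAbs]
  gcongr

theorem TrigOrth.of_hasDerivAt {m : ℕ} (hm : Odd m) {h h' : ℝ → ℝ} (hh : ContinuousOn h (Icc 0 1))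
    (hh' : ContinuousOn h' (Icc 0 1)) (hd : ∀ x ∈ Ioo (0 : ℝ) 1, HasDerivAt h (h' x) x)
    (hper : h 0 = h 1) (ho : TrigOrth m h) : TrigOrth m h' := by
  intro j
  have h1 : ∫ x in (0 : ℝ)..1, (h' x * trig (j + 1) x
      + h x * trigSum m (fun k => derivMatrix m j k) x) = h 1 * trig (j + 1) 1
        - h 0 * trig (j + 1) 0 := by
    refine intervalIntegral.integral_eq_sub_of_hasDerivAt_of_le zero_le_one
      (hh.mul (continuous_trig _).continuousOn)
      (fun x hx => (hd x hx).mul (hasDerivAt_trig hm j x)) ?_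
    exact intervalIntegrable_of_continuousOn_Icc ((hh'.mul (continuous_trig _).continuousOn).add
      (hh.mul (continuous_trigSum _ _).continuousOn))
  rw [intervalIntegral.integral_add, integral_mul_trigSum hh,
    Finset.sum_eq_zero fun k _ => by rw [ho k, mul_zero], hper, trig_zero_eq_trig_one, sub_self,
    add_zero] at h1
  · exact h1
  · exact intervalIntegrable_of_continuousOn_Icc (hh'.mul (continuous_trig _).continuousOn)
  · exact intervalIntegrable_of_continuousOn_Icc (hh.mul (continuous_trigSum _ _).continuousOn)

/-- A function of mean zero is bounded by the `L²` norm of its derivative. -/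
theorem sq_le_integral_sq_deriv {h h' : ℝ → ℝ} (hh : ContinuousOn h (Icc 0 1))
    (hh' : ContinuousOn h' (Icc 0 1)) (hd : ∀ x ∈ Ioo (0 : ℝ) 1, HasDerivAt h (h' x) x)
    (h0 : ∫ x in (0 : ℝ)..1, h x = 0) {x : ℝ} (hx : x ∈ Icc (0 : ℝ) 1) :
    h x ^ 2 ≤ ∫ y in (0 : ℝ)..1, h' y ^ 2 := by
  obtain ⟨z, hz, hz0⟩ : ∃ z ∈ Icc (0 : ℝ) 1, h z = 0 := by
    obtain ⟨z, hz, hz0⟩ := exists_hasDerivAt_eq_slope (fun t => ∫ y in (0 : ℝ)..t, h y) h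
      zero_lt_one
      (intervalIntegral.continuousOn_primitive_interval' (b₁ := 0) (b₂ := 1)
        (intervalIntegrable_of_continuousOn_Icc hh) (by simp) |>.mono
          (by rw [uIcc_of_le zero_le_one]))
      (fun t ht => intervalIntegral.integral_hasDerivAt_right
        ((intervalIntegrable_of_continuousOn_Icc hh).mono_set (by
          rw [uIcc_of_le ht.1.le, uIcc_of_le zero_le_one]
          exact Icc_subset_Icc_right ht.2.le))
        (hh.stronglyMeasurableAtFilter_nhdsWithin measurableSet_Icc t |>.filter_mono
          (by rw [nhdsWithin_eq_nhds.2 (Icc_mem_nhds ht.1 ht.2)]))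
        (hh.continuousAt (Icc_mem_nhds ht.1 ht.2)))
    exact ⟨z, Ioo_subset_Icc_self hz, by simpa [h0] using hz0⟩
  have hsub : uIcc z x ⊆ Icc (0 : ℝ) 1 := by
    rw [← uIcc_of_le zero_le_one] at hz hx ⊢
    exact uIcc_subset_uIcc hz hx
  have h1 : ∫ y in z..x, h' y = h x := by
    rw [intervalIntegral.integral_eq_sub_of_hasDeriv_right (hh.mono hsub), hz0, sub_zero]
    · intro y hy
      refine (hd y ?_).hasDerivWithinAt
      constructor
      · exact lt_of_le_of_lt (le_min hz.1 hx.1) hy.1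
      · exact lt_of_lt_of_le hy.2 (max_le hz.2 hx.2)
    · exact (hh'.mono hsub).intervalIntegrable
  have h2 : |h x| ≤ ∫ y in (0 : ℝ)..1, |h' y| := by
    rw [← h1]
    refine (intervalIntegral.norm_integral_le_integral_norm_uIoc (f := h')).trans ?_
    simp only [Real.norm_eq_abs]
    rw [intervalIntegral.integral_of_le zero_le_one]
    refine setIntegral_mono_set ?_ (Filter.Eventually.of_forall fun y => abs_nonneg _) ?_
    · exact (intervalIntegrable_of_continuousOn_Icc hh'.abs).1
    · refine (Filter.Eventually.of_forall fun y (hy : y ∈ uIoc z x) => ?_)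
      exact ⟨lt_of_le_of_lt (le_min hz.1 hx.1) hy.1, hy.2.trans (max_le hz.2 hx.2)⟩
  have h3 : ∫ y in (0 : ℝ)..1, |h' y| ^ 2 = ∫ y in (0 : ℝ)..1, h' y ^ 2 := by
    simp only [sq_abs]
  set A := ∫ y in (0 : ℝ)..1, |h' y| with hA
  have h4 : 0 ≤ ∫ y in (0 : ℝ)..1, (|h' y| - A) ^ 2 :=
    intervalIntegral.integral_nonneg zero_le_one fun y _ => sq_nonneg _
  have h5 : ∫ y in (0 : ℝ)..1, (|h' y| - A) ^ 2 = (∫ y in (0 : ℝ)..1, h' y ^ 2) - A ^ 2 := by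
    have : ∀ y, (|h' y| - A) ^ 2 = |h' y| ^ 2 - (2 * A * |h' y| - A ^ 2) := fun y => by ring
    simp only [this]
    rw [intervalIntegral.integral_sub, intervalIntegral.integral_sub, h3,
      intervalIntegral.integral_const_mul, ← hA, intervalIntegral.integral_const]
    · simp only [sub_zero, one_smul]
      ring
    · exact intervalIntegrable_of_continuousOn_Icc (continuousOn_const.mul hh'.abs)
    · exact intervalIntegrable_of_continuousOn_Icc continuousOn_const
    · exact intervalIntegrable_of_continuousOn_Icc (hh'.abs.pow 2)
    · exact intervalIntegrable_of_continuousOn_Icc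
        ((continuousOn_const.mul hh'.abs).sub continuousOn_const)
  have h6 : h x ^ 2 ≤ A ^ 2 := by
    rw [← sq_abs]
    gcongr
  linarith

theorem ContDiffOn.hasDerivAt_Icc {r : ℕ} {g : ℝ → ℝ} (hg : ContDiffOn ℝ (r + 1 : ℕ) g (Icc 0 1))
    {x : ℝ} (hx : x ∈ Ioo (0 : ℝ) 1) : HasDerivAt g (derivWithin g (Icc 0 1) x) x := by
  have h1 : DifferentiableOn ℝ g (Icc 0 1) := hg.differentiableOn (by simp)
  exact (h1 x (Ioo_subset_Icc_self hx)).hasDerivWithinAt.hasDerivAt (Icc_mem_nhds hx.1 hx.2)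

theorem ContDiffOn.derivWithin_Icc {r : ℕ} {g : ℝ → ℝ} (hg : ContDiffOn ℝ (r + 1 : ℕ) g (Icc 0 1)) :
    ContDiffOn ℝ r (derivWithin g (Icc 0 1)) (Icc 0 1) :=
  hg.derivWithin (uniqueDiffOn_Icc zero_lt_one) (by simp)

/-- The functions of regularity `r` with periodic derivatives up to the order `r - 1`. -/
def PerContDiff (r : ℕ) (g : ℝ → ℝ) : Prop :=
  ContDiffOn ℝ r g (Icc 0 1) ∧
    ∀ j < r, iteratedDerivWithin j g (Icc 0 1) 0 = iteratedDerivWithin j g (Icc 0 1) 1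

theorem PerContDiff.derivWithin {r : ℕ} {g : ℝ → ℝ} (hg : PerContDiff (r + 1) g) :
    PerContDiff r (derivWithin g (Icc 0 1)) :=
  ⟨ContDiffOn.derivWithin_Icc hg.1, fun j hj => by
    have := hg.2 (j + 1) (by omega)
    simpa only [iteratedDerivWithin_succ'] using this⟩

theorem PerContDiff.continuousOn {r : ℕ} {g : ℝ → ℝ} (hg : PerContDiff r g) :
    ContinuousOn g (Icc 0 1) := hg.1.continuousOn

theorem PerContDiff.zero_eq_one {r : ℕ} {g : ℝ → ℝ} (hg : PerContDiff (r + 1) g) : g 0 = g 1 := by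
  simpa using hg.2 0 (by omega)

theorem PerContDiff.hasDerivAt_sub {r : ℕ} {g : ℝ → ℝ} (hg : PerContDiff (r + 1) g) {m : ℕ}
    (hm : Odd m) (a : Fin m → ℝ) {x : ℝ} (hx : x ∈ Ioo (0 : ℝ) 1) :
    HasDerivAt (fun x => g x - trigSum m a x)
      (_root_.derivWithin g (Icc 0 1) x - trigSum m ((derivMatrix m)ᵀ *ᵥ a) x) x :=
  (ContDiffOn.hasDerivAt_Icc hg.1 hx).sub (hasDerivAt_trigSum hm a x)

theorem PerContDiff.trigOrth_derivWithin {r : ℕ} {g : ℝ → ℝ} (hg : PerContDiff (r + 1) g) {m : ℕ}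
    (hm : Odd m) {a : Fin m → ℝ} (ho : TrigOrth m fun x => g x - trigSum m a x) :
    TrigOrth m fun x => _root_.derivWithin g (Icc 0 1) x
      - trigSum m ((derivMatrix m)ᵀ *ᵥ a) x :=
  ho.of_hasDerivAt (h := fun x => g x - trigSum m a x) hm (hg.continuousOn.sub (continuous_trigSum _ _).continuousOn)
    (hg.derivWithin.continuousOn.sub (continuous_trigSum _ _).continuousOn)
    (fun _ hx => hg.hasDerivAt_sub hm a hx)
    (by simp only [hg.zero_eq_one, trigSum_zero_eq_trigSum_one])

/-- The approximation error of a smooth periodic function by trigonometric polynomials. -/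
theorem PerContDiff.approx {m : ℕ} (hm : Odd m) (r : ℕ) : ∀ {g : ℝ → ℝ}, PerContDiff r g →
    ∀ {a : Fin m → ℝ}, (TrigOrth m fun x => g x - trigSum m a x) →
    (m : ℝ) ^ (2 * r) * ∫ x in (0 : ℝ)..1, (g x - trigSum m a x) ^ 2
      ≤ ∫ x in (0 : ℝ)..1, iteratedDerivWithin r g (Icc 0 1) x ^ 2 := by
  induction r with
  | zero =>
    intro g hg a ho
    simpa using ho.integral_sq_le hg.continuousOn
  | succ r ih =>
    intro g hg a ho
    have h1 := ih hg.derivWithin (hg.trigOrth_derivWithin hm ho)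
    have h2 := ho.wirtinger (h := fun x => g x - trigSum m a x)
      (h' := fun x => _root_.derivWithin g (Icc 0 1) x - trigSum m ((derivMatrix m)ᵀ *ᵥ a) x) hm
      (hg.continuousOn.sub (continuous_trigSum _ _).continuousOn)
      (hg.derivWithin.continuousOn.sub (continuous_trigSum _ _).continuousOn)
      (fun _ hx => hg.hasDerivAt_sub hm a hx)
      (by simp only [hg.zero_eq_one, trigSum_zero_eq_trigSum_one])
    simp only [iteratedDerivWithin_succ']
    refine le_trans (le_of_eq ?_) ((mul_le_mul_of_nonneg_left h2 (by positivity)).trans h1)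
    rw [← mul_assoc]
    ring_nf

theorem trigSum_zero (m : ℕ) (x : ℝ) : trigSum m 0 x = 0 := by
  simp [trigSum]

/-- The derivative of a function of the periodic Sobolev class is bounded by the radius. -/
theorem PerContDiff.derivWithin_sq_le {r : ℕ} {g : ℝ → ℝ} (hg : PerContDiff (r + 2) g)
    {x : ℝ} (hx : x ∈ Icc (0 : ℝ) 1) :
    _root_.derivWithin g (Icc 0 1) x ^ 2
      ≤ ∫ x in (0 : ℝ)..1, iteratedDerivWithin (r + 2) g (Icc 0 1) x ^ 2 := by
  have key : ∀ {s : ℕ} {g : ℝ → ℝ}, PerContDiff (s + 1) g →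
      TrigOrth 1 (_root_.derivWithin g (Icc 0 1)) := by
    intro s g hg j
    have h1 : trig ((j : ℕ) + 1) = fun _ => (1 : ℝ) := by
      rw [show (j : ℕ) + 1 = 1 by omega, trig_one]
    rw [h1]
    simp only [mul_one]
    rw [intervalIntegral.integral_eq_sub_of_hasDerivAt_of_le zero_le_one hg.continuousOn
      (fun x hx => ContDiffOn.hasDerivAt_Icc hg.1 hx)
      (intervalIntegrable_of_continuousOn_Icc hg.derivWithin.continuousOn), hg.zero_eq_one,
      sub_self]
  have h1 := hg.derivWithin
  have h2 := h1.derivWithin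
  have h3 : ∫ x in (0 : ℝ)..1, _root_.derivWithin g (Icc 0 1) x = 0 := by
    simpa [trig_one] using key hg 0
  refine (sq_le_integral_sq_deriv h1.continuousOn h2.continuousOn
    (fun x hx => ContDiffOn.hasDerivAt_Icc h1.1 hx) h3 hx).trans ?_
  have h4 := h2.approx (m := 1) odd_one r (a := 0) (by simpa [trigSum_zero] using key h1)
  simpa [trigSum_zero, iteratedDerivWithin_succ'] using h4

theorem PerSobolev.perContDiff {β : ℕ} {L : ℝ} {b : ℝ → ℝ} (hb : b ∈ PerSobolev β L) :
    PerContDiff β b := ⟨hb.1, hb.2.2.2⟩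

theorem PerSobolev.derivWithin_sq_le {β : ℕ} (hβ : 1 < β) {L : ℝ} {b : ℝ → ℝ}
    (hb : b ∈ PerSobolev β L) {x : ℝ} (hx : x ∈ Icc (0 : ℝ) 1) :
    derivWithin b (Icc 0 1) x ^ 2 ≤ L ^ 2 := by
  obtain ⟨r, rfl⟩ : ∃ r, β = r + 2 := ⟨β - 2, by omega⟩
  exact ((PerSobolev.perContDiff hb).derivWithin_sq_le hx).trans hb.2.2.1

/-- Approximation of a function of the periodic Sobolev class, and of its derivative, by a
trigonometric polynomial and its derivative. -/
theorem PerSobolev.exists_approx {β : ℕ} (hβ : 1 < β) {L : ℝ} {b : ℝ → ℝ}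
    (hb : b ∈ PerSobolev β L) {m : ℕ} (hm : Odd m) :
    ∃ a : Fin m → ℝ,
      (m : ℝ) ^ (2 * β) * ∫ x in (0 : ℝ)..1, (b x - trigSum m a x) ^ 2 ≤ L ^ 2 ∧
      (m : ℝ) ^ (2 * (β - 1)) * ∫ x in (0 : ℝ)..1, (derivWithin b (Icc 0 1) x
        - trigSum m ((derivMatrix m)ᵀ *ᵥ a) x) ^ 2 ≤ L ^ 2 ∧
      ∀ x ∈ Icc (0 : ℝ) 1, (b x - trigSum m a x) ^ 2 ≤ L ^ 2 := by
  have hp := PerSobolev.perContDiff hb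
  obtain ⟨r, rfl⟩ : ∃ r, β = r + 2 := ⟨β - 2, by omega⟩
  have ho := trigOrth_sub_projection (m := m) hp.continuousOn
  refine ⟨_, (hp.approx hm _ ho).trans hb.2.2.1, ?_⟩
  set a : Fin m → ℝ := fun j => ∫ x in (0 : ℝ)..1, b x * trig (j + 1) x
  have h1 : (m : ℝ) ^ (2 * (r + 2 - 1)) * ∫ x in (0 : ℝ)..1, (derivWithin b (Icc 0 1) x
      - trigSum m ((derivMatrix m)ᵀ *ᵥ a) x) ^ 2 ≤ L ^ 2 := by
    refine (hp.derivWithin.approx hm _ (hp.trigOrth_derivWithin hm ho)).trans ?_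
    have := hb.2.2.1
    rwa [iteratedDerivWithin_succ'] at this
  refine ⟨h1, fun x hx => ?_⟩
  have hm1 : 1 ≤ (m : ℝ) := by exact_mod_cast hm.pos
  have h0 : ∫ x in (0 : ℝ)..1, (b x - trigSum m a x) = 0 := by
    simpa [trig_one] using ho ⟨0, hm.pos⟩
  refine (sq_le_integral_sq_deriv (h := fun x => b x - trigSum m a x)
    (h' := fun x => derivWithin b (Icc 0 1) x - trigSum m ((derivMatrix m)ᵀ *ᵥ a) x)
    (hp.continuousOn.sub (continuous_trigSum _ _).continuousOn)
    (hp.derivWithin.continuousOn.sub (continuous_trigSum _ _).continuousOn)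
    (fun _ hx => hp.hasDerivAt_sub hm a hx) h0 hx).trans (le_trans ?_ h1)
  exact le_mul_of_one_le_left (intervalIntegral.integral_nonneg zero_le_one fun _ _ => sq_nonneg _)
    (one_le_pow₀ hm1)

section

theorem indicator_trigSum (m : ℕ) (a : Fin m → ℝ) (t : ℝ) :
    (Icc (0 : ℝ) 1).indicator (trigSum m a) t = ∑ j : Fin m, a j * phi (j + 1) t := by
  by_cases ht : t ∈ Icc (0 : ℝ) 1
  · simp [phi, trigSum, indicator_of_mem ht]
  · simp [phi, indicator_of_notMem ht]

variable {n : ℕ}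

theorem designMatrix_mulVec (m : ℕ) (x : Fin n → ℝ) (a : Fin m → ℝ) (i : Fin n) :
    (designMatrix m x *ᵥ a) i = (Icc (0 : ℝ) 1).indicator (trigSum m a) (x i) := by
  rw [indicator_trigSum]
  simp only [Matrix.mulVec, dotProduct, designMatrix, Matrix.of_apply]
  exact Finset.sum_congr rfl fun j _ => mul_comm _ _

theorem dotProduct_empGram (m : ℕ) (x : Fin n → ℝ) (v w : Fin m → ℝ) :
    v ⬝ᵥ (empGram m x *ᵥ w)
      = (1 / (n : ℝ)) * ((designMatrix m x *ᵥ v) ⬝ᵥ (designMatrix m x *ᵥ w)) := by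
  rw [empGram, Matrix.smul_mulVec, dotProduct_smul, smul_eq_mul, ← Matrix.mulVec_mulVec,
    Matrix.dotProduct_mulVec, Matrix.vecMul_transpose]

theorem empGram_transpose (m : ℕ) (x : Fin n → ℝ) : (empGram m x)ᵀ = empGram m x := by
  simp [empGram, Matrix.transpose_smul, Matrix.transpose_mul]

theorem empNormSq_trigSum (m : ℕ) (x : Fin n → ℝ) (v : Fin m → ℝ) :
    empNormSq x (trigSum m v) = v ⬝ᵥ (empGram m x *ᵥ v) := by
  rw [dotProduct_empGram, empNormSq]
  congr 1
  simp only [dotProduct, designMatrix_mulVec, sq]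

theorem derivCoeff_antisymm {j k : ℕ} (hj : 1 ≤ j) (hk : 1 ≤ k) :
    derivCoeff j k = -derivCoeff k j := by
  unfold derivCoeff
  by_cases hje : Even j <;> by_cases hke : Even k
  · have h1 : k ≠ j + 1 := by
      rintro rfl
      exact (Nat.even_add_one.1 hke) hje
    have h2 : j ≠ k + 1 := by
      rintro rfl
      exact (Nat.even_add_one.1 hje) hke
    simp [hje, hke, h1, h2]
  · by_cases h : k = j + 1
    · subst h
      have h2 : (j + 1) / 2 = j / 2 := by
        obtain ⟨r, hr⟩ := hje
        omega
      simp [hje, hke, h2]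
    · have h' : ¬ (j + 1 = k) := fun h' => h h'.symm
      simp [hje, hke, h, h']
  · by_cases h : k + 1 = j
    · subst h
      have h2 : (k + 1) / 2 = k / 2 := by
        obtain ⟨r, hr⟩ := hke
        omega
      simp [hje, hke, h2]
    · have h' : ¬ (j = k + 1) := fun h' => h h'.symm
      simp [hje, hke, h, h']
  · by_cases h1 : k + 1 = j
    · subst h1
      exact absurd (Nat.even_add_one.2 hke) hje
    · by_cases h2 : j + 1 = k
      · subst h2
        exact absurd (Nat.even_add_one.2 hje) hke
      · simp [hje, hke, h1, h2]

theorem derivMatrix_transpose (m : ℕ) : (derivMatrix m)ᵀ = -derivMatrix m := by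
  ext j k
  simp only [derivMatrix, Matrix.transpose_apply, Matrix.neg_apply, Matrix.of_apply]
  exact derivCoeff_antisymm (by omega) (by omega)

theorem sum_abs_derivMatrix_le (m : ℕ) (j : Fin m) :
    ∑ k, |derivMatrix m j k| ≤ 4 * (m : ℝ) := by
  have hq : 2 * Real.pi * ((((j : ℕ) + 1) / 2 : ℕ) : ℝ) ≤ 4 * m := by
    have h1 : 2 * ((((j : ℕ) + 1) / 2 : ℕ) : ℝ) ≤ m := by
      have := j.2
      exact_mod_cast (show 2 * (((j : ℕ) + 1) / 2) ≤ m by omega)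
    nlinarith [Real.pi_lt_four, Real.pi_pos, Nat.cast_nonneg (α := ℝ) (((j : ℕ) + 1) / 2)]
  have hq0 : 0 ≤ 2 * Real.pi * ((((j : ℕ) + 1) / 2 : ℕ) : ℝ) := by positivity
  obtain ⟨t, ht⟩ : ∃ t : ℕ, ∀ k : Fin m, |derivMatrix m j k|
      ≤ if (k : ℕ) + 1 = t then 4 * (m : ℝ) else 0 := by
    by_cases hj : Even ((j : ℕ) + 1)
    · refine ⟨(j : ℕ) + 1 + 1, fun k => ?_⟩
      simp only [derivMatrix, Matrix.of_apply, derivCoeff, if_pos hj]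
      split_ifs with h
      · rwa [abs_neg, abs_of_nonneg hq0]
      · simp
    · refine ⟨(j : ℕ), fun k => ?_⟩
      simp only [derivMatrix, Matrix.of_apply, derivCoeff, if_neg hj, add_left_inj]
      split_ifs with h
      · rwa [abs_of_nonneg hq0]
      · simp
  refine (Finset.sum_le_sum fun k _ => ht k).trans ?_
  rw [Fin.sum_univ_eq_sum_range (fun k => if k + 1 = t then 4 * (m : ℝ) else 0)]
  cases t with
  | zero => simp
  | succ t =>
    simp only [add_left_inj, Finset.sum_ite_eq']
    split_ifs
    · exact le_rfl
    · positivity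

/-- The derivation is bounded, with a bound of the order of the dimension, on trigonometric
polynomials. -/
theorem dotProduct_derivMatrix_mulVec_le (m : ℕ) (v : Fin m → ℝ) :
    ((derivMatrix m)ᵀ *ᵥ v) ⬝ᵥ ((derivMatrix m)ᵀ *ᵥ v) ≤ 16 * (m : ℝ) ^ 2 * (v ⬝ᵥ v) := by
  rw [derivMatrix_transpose, Matrix.neg_mulVec, neg_dotProduct_neg]
  have h1 : ∀ j, (derivMatrix m *ᵥ v) j * (derivMatrix m *ᵥ v) j
      ≤ 4 * (m : ℝ) * ∑ k, |derivMatrix m j k| * v k ^ 2 := by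
    intro j
    have h2 : ((derivMatrix m *ᵥ v) j) ^ 2
        ≤ (∑ k, |derivMatrix m j k|) * ∑ k, |derivMatrix m j k| * v k ^ 2 := by
      refine Finset.sum_sq_le_sum_mul_sum_of_sq_le_mul Finset.univ
        (r := fun k => derivMatrix m j k * v k) (f := fun k => |derivMatrix m j k|)
        (g := fun k => |derivMatrix m j k| * v k ^ 2) (fun k _ => abs_nonneg _)
        (fun k _ => by positivity) fun k _ => le_of_eq ?_
      rw [mul_pow, ← sq_abs (derivMatrix m j k)]
      ring
    rw [← sq]
    exact h2.trans (mul_le_mul_of_nonneg_right (sum_abs_derivMatrix_le m j)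
      (Finset.sum_nonneg fun k _ => by positivity))
  have h3 : ∀ k, ∑ j, |derivMatrix m j k| ≤ 4 * (m : ℝ) := by
    intro k
    refine le_trans (le_of_eq ?_) (sum_abs_derivMatrix_le m k)
    refine Finset.sum_congr rfl fun j _ => ?_
    have := congrFun (congrFun (derivMatrix_transpose m) k) j
    rw [Matrix.transpose_apply, Matrix.neg_apply] at this
    rw [this, abs_neg]
  calc (derivMatrix m *ᵥ v) ⬝ᵥ (derivMatrix m *ᵥ v)
      ≤ ∑ j, 4 * (m : ℝ) * ∑ k, |derivMatrix m j k| * v k ^ 2 := Finset.sum_le_sum fun j _ => h1 j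
    _ = 4 * (m : ℝ) * ∑ k, (∑ j, |derivMatrix m j k|) * v k ^ 2 := by
        rw [← Finset.mul_sum, Finset.sum_comm]
        simp only [Finset.sum_mul]
    _ ≤ 4 * (m : ℝ) * ∑ k, (4 * (m : ℝ)) * v k ^ 2 := by
        gcongr with k
        exact h3 k
    _ = 16 * (m : ℝ) ^ 2 * (v ⬝ᵥ v) := by
        rw [← Finset.mul_sum]
        simp only [dotProduct, sq]
        ring

/-- The least squares matrix `n⁻¹ Ψ̂⁻¹ Φ̂ᵀ`. -/
def lsMatrix (m : ℕ) (x : Fin n → ℝ) : Matrix (Fin m) (Fin n) ℝ :=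
  (empGram m x)⁻¹ * ((1 / (n : ℝ)) • (designMatrix m x)ᵀ)

theorem lsMatrix_mul_designMatrix {m : ℕ} {x : Fin n → ℝ} (hu : IsUnit (empGram m x)) :
    lsMatrix m x * designMatrix m x = 1 := by
  rw [lsMatrix, Matrix.mul_assoc, Matrix.smul_mul]
  exact Matrix.nonsing_inv_mul _ ((Matrix.isUnit_iff_isUnit_det _).1 hu)

theorem coeff_eq (m : ℕ) (x y : Fin n → ℝ) :
    coeff m x y = (derivMatrix m)ᵀ *ᵥ (lsMatrix m x *ᵥ y) := by
  rw [coeff, lsMatrix, derivMatrix_transpose, Matrix.neg_mulVec, ← Matrix.mulVec_mulVec,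
    Matrix.smul_mulVec, Matrix.mulVec_smul, Matrix.mulVec_smul]

/-- Only the observations in the interval matter. -/
theorem lsMatrix_mulVec_congr {m : ℕ} {x y z : Fin n → ℝ}
    (h : ∀ i, x i ∈ Icc (0 : ℝ) 1 → y i = z i) : lsMatrix m x *ᵥ y = lsMatrix m x *ᵥ z := by
  rw [lsMatrix, ← Matrix.mulVec_mulVec, ← Matrix.mulVec_mulVec]
  congr 1
  rw [Matrix.smul_mulVec, Matrix.smul_mulVec]
  congr 1
  funext j
  simp only [Matrix.mulVec, dotProduct, Matrix.transpose_apply, designMatrix, Matrix.of_apply]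
  refine Finset.sum_congr rfl fun i _ => ?_
  by_cases hi : x i ∈ Icc (0 : ℝ) 1
  · rw [h i hi]
  · rw [phi, indicator_of_notMem hi, zero_mul, zero_mul]

theorem empNormSq_nonneg (x : Fin n → ℝ) (g : ℝ → ℝ) : 0 ≤ empNormSq x g := by
  unfold empNormSq
  positivity

theorem empNormSq_le {x : Fin n → ℝ} {g : ℝ → ℝ} {B : ℝ} (hB : 0 ≤ B)
    (hg : ∀ t ∈ Icc (0 : ℝ) 1, g t ^ 2 ≤ B) : empNormSq x g ≤ B := by
  unfold empNormSq
  have h1 : ∑ i, ((Icc (0 : ℝ) 1).indicator g (x i)) ^ 2 ≤ ∑ _i : Fin n, B := by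
    refine Finset.sum_le_sum fun i _ => ?_
    by_cases hi : x i ∈ Icc (0 : ℝ) 1
    · rw [indicator_of_mem hi]
      exact hg _ hi
    · rw [indicator_of_notMem hi]
      simpa using hB
  rw [Finset.sum_const, Finset.card_univ, Fintype.card_fin, nsmul_eq_mul] at h1
  rcases Nat.eq_zero_or_pos n with rfl | hn
  · simpa using hB
  · have hn' : (0 : ℝ) < n := by exact_mod_cast hn
    rw [one_div, inv_mul_le_iff₀ hn']
    exact h1

theorem empNormSq_congr {x : Fin n → ℝ} {g h : ℝ → ℝ}
    (hgh : ∀ t ∈ Icc (0 : ℝ) 1, g t = h t) : empNormSq x g = empNormSq x h := by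
  unfold empNormSq
  rw [indicator_congr hgh]

theorem empNormSq_sub_le (x : Fin n → ℝ) (g h : ℝ → ℝ) :
    empNormSq x (fun t => g t - h t) ≤ 2 * empNormSq x g + 2 * empNormSq x h := by
  have h1 : ∑ i, ((Icc (0 : ℝ) 1).indicator (fun t => g t - h t) (x i)) ^ 2
      ≤ ∑ i, (2 * ((Icc (0 : ℝ) 1).indicator g (x i)) ^ 2
        + 2 * ((Icc (0 : ℝ) 1).indicator h (x i)) ^ 2) := by
    refine Finset.sum_le_sum fun i _ => ?_
    by_cases hi : x i ∈ Icc (0 : ℝ) 1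
    · simp only [indicator_of_mem hi]
      nlinarith [sq_nonneg (g (x i) + h (x i))]
    · simp [indicator_of_notMem hi]
  rw [Finset.sum_add_distrib, ← Finset.mul_sum, ← Finset.mul_sum] at h1
  have h2 := mul_le_mul_of_nonneg_left h1 (show 0 ≤ 1 / (n : ℝ) by positivity)
  unfold empNormSq
  linarith

/-- The empirical Gram matrix is bounded above, and below by `κ`, as a quadratic form. -/
def GramBounds (m : ℕ) (x : Fin n → ℝ) (κ K : ℝ) : Prop :=
  ∀ v : Fin m → ℝ, κ * (v ⬝ᵥ v) ≤ v ⬝ᵥ (empGram m x *ᵥ v) ∧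
    v ⬝ᵥ (empGram m x *ᵥ v) ≤ K * (v ⬝ᵥ v)

theorem empGram_mulVec_lsMatrix {m : ℕ} {x : Fin n → ℝ} (hu : IsUnit (empGram m x))
    (w : Fin n → ℝ) :
    empGram m x *ᵥ (lsMatrix m x *ᵥ w) = (1 / (n : ℝ)) • ((designMatrix m x)ᵀ *ᵥ w) := by
  rw [lsMatrix, Matrix.mulVec_mulVec, ← Matrix.mul_assoc,
    Matrix.mul_nonsing_inv _ ((Matrix.isUnit_iff_isUnit_det _).1 hu), Matrix.one_mul,
    Matrix.smul_mulVec]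

theorem GramBounds.lsMatrix_mulVec_le {m : ℕ} {x : Fin n → ℝ} {κ K : ℝ}
    (hx : GramBounds m x κ K) (hu : IsUnit (empGram m x)) (w : Fin n → ℝ) :
    κ * ((lsMatrix m x *ᵥ w) ⬝ᵥ (lsMatrix m x *ᵥ w)) ≤ (1 / (n : ℝ)) * (w ⬝ᵥ w) := by
  set v := lsMatrix m x *ᵥ w with hv
  refine (hx v).1.trans ?_
  have h1 := dotProduct_empGram m x v v
  have h2 : v ⬝ᵥ (empGram m x *ᵥ v) = (1 / (n : ℝ)) * ((designMatrix m x *ᵥ v) ⬝ᵥ w) := by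
    conv_lhs => rw [hv, empGram_mulVec_lsMatrix hu, ← hv]
    rw [dotProduct_smul, smul_eq_mul, Matrix.dotProduct_mulVec, Matrix.vecMul_transpose]
  have h3 : 0 ≤ (1 / (n : ℝ)) * ((designMatrix m x *ᵥ v - w) ⬝ᵥ (designMatrix m x *ᵥ v - w)) :=
    mul_nonneg (by positivity) (Finset.sum_nonneg fun i _ => mul_self_nonneg _)
  rw [sub_dotProduct, dotProduct_sub, dotProduct_sub, dotProduct_comm w (designMatrix m x *ᵥ v)]
    at h3
  linarith

theorem GramBounds.sum_sq_lsMatrix_le {m : ℕ} {x : Fin n → ℝ} {κ K : ℝ} (hκ : 0 < κ)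
    (hx : GramBounds m x κ K) (hu : IsUnit (empGram m x)) :
    ∑ j, ∑ i, lsMatrix m x j i ^ 2 ≤ (m : ℝ) / (κ * n) := by
  have hdet := (Matrix.isUnit_iff_isUnit_det _).1 hu
  have h1 : lsMatrix m x * (lsMatrix m x)ᵀ = (1 / (n : ℝ)) • (empGram m x)⁻¹ := by
    have h2 : (lsMatrix m x)ᵀ = (1 / (n : ℝ)) • (designMatrix m x * (empGram m x)⁻¹) := by
      rw [lsMatrix, Matrix.transpose_mul, Matrix.transpose_nonsing_inv, empGram_transpose,
        Matrix.transpose_smul, Matrix.transpose_transpose, Matrix.smul_mul]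
    rw [h2, Matrix.mul_smul, ← Matrix.mul_assoc, lsMatrix_mul_designMatrix hu, Matrix.one_mul]
  have h2 : ∀ j, (empGram m x)⁻¹ j j ≤ 1 / κ := by
    intro j
    set w := (empGram m x)⁻¹ *ᵥ Pi.single j 1 with hw
    have h3 := (hx w).1
    have h4 : empGram m x *ᵥ w = Pi.single j 1 := by
      rw [hw, Matrix.mulVec_mulVec, Matrix.mul_nonsing_inv _ hdet, Matrix.one_mulVec]
    have h5 : w j = (empGram m x)⁻¹ j j := by
      rw [hw, Matrix.mulVec_single_one, Matrix.col_apply]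
    rw [h4, dotProduct_single_one] at h3
    have h6 : w j * w j ≤ w ⬝ᵥ w :=
      Finset.single_le_sum (f := fun k => w k * w k) (fun k _ => mul_self_nonneg _)
        (Finset.mem_univ j)
    rw [← h5, le_div_iff₀ hκ]
    by_contra! hc
    have h7 : 0 < w j := by
      by_contra! h8
      nlinarith
    nlinarith [mul_le_mul_of_nonneg_left h6 hκ.le]
  have h3 : ∀ j, ∑ i, lsMatrix m x j i ^ 2 = (1 / (n : ℝ)) * (empGram m x)⁻¹ j j := by
    intro j
    have := congrFun (congrFun h1 j) j
    rw [Matrix.mul_apply, Matrix.smul_apply, smul_eq_mul] at this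
    rw [← this]
    exact Finset.sum_congr rfl fun i _ => by rw [Matrix.transpose_apply, sq]
  simp only [h3]
  calc ∑ j, (1 / (n : ℝ)) * (empGram m x)⁻¹ j j ≤ ∑ _j : Fin m, (1 / (n : ℝ)) * (1 / κ) :=
        Finset.sum_le_sum fun j _ => mul_le_mul_of_nonneg_left (h2 j) (by positivity)
    _ = (m : ℝ) / (κ * n) := by
        rw [Finset.sum_const, Finset.card_univ, Fintype.card_fin, nsmul_eq_mul]
        rw [mul_comm κ, one_div_mul_one_div, mul_one_div]

theorem truncEstimator_sub_of_stable {m : ℕ} {x : Fin n → ℝ} (hs : Stable m x)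
    (a : Fin m → ℝ) (b b' : ℝ → ℝ) (e : Fin n → ℝ) {t : ℝ} (ht : t ∈ Icc (0 : ℝ) 1) :
    truncEstimator m x (fun i => b (x i) + e i) t - b' t
      = trigSum m ((derivMatrix m)ᵀ *ᵥ (lsMatrix m x *ᵥ fun i => e i
          + (Icc (0 : ℝ) 1).indicator (fun t => b t - trigSum m a t) (x i))) t
        - (b' t - trigSum m ((derivMatrix m)ᵀ *ᵥ a) t) := by
  have h1 : lsMatrix m x *ᵥ (fun i => b (x i) + e i)
      = a + lsMatrix m x *ᵥ fun i => e i
          + (Icc (0 : ℝ) 1).indicator (fun t => b t - trigSum m a t) (x i) := by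
    have h2 : a = lsMatrix m x *ᵥ (designMatrix m x *ᵥ a) := by
      rw [Matrix.mulVec_mulVec, lsMatrix_mul_designMatrix hs.1, Matrix.one_mulVec]
    refine Eq.trans ?_ (congrArg (· + lsMatrix m x *ᵥ fun i => e i
      + (Icc (0 : ℝ) 1).indicator (fun t => b t - trigSum m a t) (x i)) h2).symm
    rw [← Matrix.mulVec_add]
    refine lsMatrix_mulVec_congr fun i hi => ?_
    rw [Pi.add_apply, designMatrix_mulVec, indicator_of_mem hi, indicator_of_mem hi]
    ring
  have h3 : ∀ c d : Fin m → ℝ, trigSum m (c + d) t = trigSum m c t + trigSum m d t := by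
    intro c d
    simp only [trigSum, Pi.add_apply, add_mul, Finset.sum_add_distrib]
  rw [truncEstimator, if_pos hs, estimator, ← indicator_trigSum, indicator_of_mem ht, coeff_eq,
    h1, Matrix.mulVec_add, h3]
  ring

/-- The error on the truncation event. -/
theorem GramBounds.error_le {m : ℕ} {x : Fin n → ℝ} {κ K : ℝ} (hκ : 0 < κ) (hK : 0 ≤ K)
    (hx : GramBounds m x κ K) (hs : Stable m x) (a : Fin m → ℝ) (b b' : ℝ → ℝ) (e : Fin n → ℝ) :
    empNormSq x (fun t => truncEstimator m x (fun i => b (x i) + e i) t - b' t)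
      ≤ 2 * empNormSq x (fun t => b' t - trigSum m ((derivMatrix m)ᵀ *ᵥ a) t)
        + 64 * K * (m : ℝ) ^ 2 * (((lsMatrix m x *ᵥ e) ⬝ᵥ (lsMatrix m x *ᵥ e))
          + empNormSq x (fun t => b t - trigSum m a t) / κ) := by
  rw [empNormSq_congr fun t ht => truncEstimator_sub_of_stable hs a b b' e ht]
  refine (empNormSq_sub_le _ _ _).trans ?_
  rw [add_comm, empNormSq_trigSum]
  set r : Fin n → ℝ := fun i => (Icc (0 : ℝ) 1).indicator (fun t => b t - trigSum m a t) (x i)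
    with hr
  have h0 : lsMatrix m x *ᵥ (fun i => e i
      + (Icc (0 : ℝ) 1).indicator (fun t => b t - trigSum m a t) (x i))
      = lsMatrix m x *ᵥ e + lsMatrix m x *ᵥ r := by
    rw [← Matrix.mulVec_add]
    rfl
  rw [h0]
  set v := lsMatrix m x *ᵥ e
  set w := lsMatrix m x *ᵥ r with hw
  have h1 : (v + w) ⬝ᵥ (v + w) ≤ 2 * (v ⬝ᵥ v) + 2 * (w ⬝ᵥ w) := by
    have : 0 ≤ (v - w) ⬝ᵥ (v - w) := Finset.sum_nonneg fun i _ => mul_self_nonneg _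
    simp only [sub_dotProduct, dotProduct_sub, add_dotProduct, dotProduct_add] at this ⊢
    linarith
  have h2 : w ⬝ᵥ w ≤ empNormSq x (fun t => b t - trigSum m a t) / κ := by
    rw [le_div_iff₀ hκ, mul_comm]
    refine (hx.lsMatrix_mulVec_le hs.1 r).trans (le_of_eq ?_)
    rw [empNormSq]
    congr 1
    exact Finset.sum_congr rfl fun i _ => (sq _).symm
  have h3 := (hx ((derivMatrix m)ᵀ *ᵥ (v + w))).2
  have h4 := dotProduct_derivMatrix_mulVec_le m (v + w)
  have h5 : ((derivMatrix m)ᵀ *ᵥ (v + w)) ⬝ᵥ (empGram m x *ᵥ ((derivMatrix m)ᵀ *ᵥ (v + w)))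
      ≤ K * (16 * (m : ℝ) ^ 2 * (2 * (v ⬝ᵥ v) + 2 * (empNormSq x
        (fun t => b t - trigSum m a t) / κ))) := by
    refine h3.trans (mul_le_mul_of_nonneg_left (h4.trans ?_) hK)
    refine mul_le_mul_of_nonneg_left ?_ (by positivity)
    linarith
  linarith

theorem dotProduct_empGram_le (m : ℕ) (x : Fin n → ℝ) (v : Fin m → ℝ) :
    v ⬝ᵥ (empGram m x *ᵥ v) ≤ 2 * m * (v ⬝ᵥ v) := by
  rw [← empNormSq_trigSum]
  have hv : 0 ≤ v ⬝ᵥ v := Finset.sum_nonneg fun i _ => mul_self_nonneg _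
  refine empNormSq_le (by positivity) fun t _ => ?_
  refine (Finset.sum_mul_sq_le_sq_mul_sq _ _ _).trans ?_
  rw [mul_comm]
  refine mul_le_mul ?_ (le_of_eq ?_) (Finset.sum_nonneg fun _ _ => sq_nonneg _) (by positivity)
  · refine (Finset.sum_le_sum fun j _ => trig_sq_le _ t).trans (le_of_eq ?_)
    simp [mul_comm]
  · exact Finset.sum_congr rfl fun _ _ => sq _

theorem inner_toEuclidean (m : ℕ) (v w : Fin m → ℝ) :
    inner ℝ (WithLp.toLp 2 v : EuclideanSpace ℝ (Fin m)) (WithLp.toLp 2 w) = v ⬝ᵥ w := by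
  rw [EuclideanSpace.inner_toLp_toLp]
  simp [dotProduct_comm]

theorem dotProduct_mulVec_le_opNorm {m : ℕ} (A : Matrix (Fin m) (Fin m) ℝ) (v : Fin m → ℝ) :
    v ⬝ᵥ (A *ᵥ v) ≤ opNorm A * (v ⬝ᵥ v) := by
  have h1 := real_inner_le_norm (WithLp.toLp 2 v : EuclideanSpace ℝ (Fin m))
    (Matrix.toEuclideanCLM (𝕜 := ℝ) A (WithLp.toLp 2 v))
  have h2 := (Matrix.toEuclideanCLM (𝕜 := ℝ) A).le_opNorm (WithLp.toLp 2 v)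
  have h3 : ‖(WithLp.toLp 2 v : EuclideanSpace ℝ (Fin m))‖ ^ 2 = v ⬝ᵥ v := by
    rw [← real_inner_self_eq_norm_sq, inner_toEuclidean]
  rw [Matrix.toEuclideanCLM_toLp, inner_toEuclidean] at h1
  rw [Matrix.toEuclideanCLM_toLp] at h2
  rw [← h3, opNorm]
  nlinarith [norm_nonneg (WithLp.toLp 2 v : EuclideanSpace ℝ (Fin m))]

theorem gramBounds_of_isUnit {m : ℕ} {x : Fin n → ℝ} (hu : IsUnit (empGram m x)) :
    GramBounds m x (max (opNorm (empGram m x)⁻¹) 1)⁻¹ (2 * m) := by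
  intro v
  refine ⟨?_, dotProduct_empGram_le m x v⟩
  have hdet := (Matrix.isUnit_iff_isUnit_det _).1 hu
  set lam := max (opNorm (empGram m x)⁻¹) 1
  have hl : 0 < lam := lt_of_lt_of_le one_pos (le_max_right _ _)
  rw [inv_mul_le_iff₀ hl]
  have hvv : 0 ≤ v ⬝ᵥ v := Finset.sum_nonneg fun i _ => mul_self_nonneg _
  set w := (empGram m x)⁻¹ *ᵥ v with hw
  have h1 : empGram m x *ᵥ w = v := by
    rw [hw, Matrix.mulVec_mulVec, Matrix.mul_nonsing_inv _ hdet, Matrix.one_mulVec]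
  have h2 : v ⬝ᵥ w ≤ lam * (v ⬝ᵥ v) :=
    (dotProduct_mulVec_le_opNorm _ v).trans (mul_le_mul_of_nonneg_right (le_max_left _ _) hvv)
  have h3 : (v ⬝ᵥ v) ^ 2 ≤ (v ⬝ᵥ (empGram m x *ᵥ v)) * (v ⬝ᵥ w) := by
    have e1 : v ⬝ᵥ v = v ⬝ᵥ (empGram m x *ᵥ w) := by rw [h1]
    have e2 : v ⬝ᵥ w = w ⬝ᵥ (empGram m x *ᵥ w) := by rw [h1, dotProduct_comm]
    rw [e1, e2, dotProduct_empGram, dotProduct_empGram, dotProduct_empGram, mul_pow,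
      mul_mul_mul_comm, ← sq]
    refine mul_le_mul_of_nonneg_left ?_ (sq_nonneg _)
    refine (Finset.sum_mul_sq_le_sq_mul_sq _ _ _).trans (le_of_eq ?_)
    simp only [dotProduct, sq]
  have h4 : 0 ≤ v ⬝ᵥ (empGram m x *ᵥ v) := by
    rw [← empNormSq_trigSum]
    exact empNormSq_nonneg _ _
  by_contra! hc
  have h5 : 0 < v ⬝ᵥ v := lt_of_le_of_lt (by positivity) hc
  nlinarith [mul_le_mul_of_nonneg_left h2 h4, mul_lt_mul_of_pos_right hc h5]

theorem GramBounds.isUnit {m : ℕ} {x : Fin n → ℝ} {κ K : ℝ} (hκ : 0 < κ)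
    (hx : GramBounds m x κ K) : IsUnit (empGram m x) := by
  rw [← Matrix.mulVec_injective_iff_isUnit]
  intro v w hvw
  have h1 : empGram m x *ᵥ (v - w) = 0 := by
    rw [Matrix.mulVec_sub]
    exact sub_eq_zero.2 hvw
  have h2 := (hx (v - w)).1
  rw [h1, dotProduct_zero] at h2
  have h3 : 0 ≤ (v - w) ⬝ᵥ (v - w) := Finset.sum_nonneg fun i _ => mul_self_nonneg _
  have h4 : (v - w) ⬝ᵥ (v - w) = 0 := by nlinarith
  exact sub_eq_zero.1 (dotProduct_self_eq_zero.1 h4)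

theorem GramBounds.opNorm_inv_le {m : ℕ} {x : Fin n → ℝ} {κ K : ℝ} (hκ : 0 < κ)
    (hx : GramBounds m x κ K) : opNorm (empGram m x)⁻¹ ≤ 1 / κ := by
  have hdet := (Matrix.isUnit_iff_isUnit_det _).1 (hx.isUnit hκ)
  refine ContinuousLinearMap.opNorm_le_bound _ (by positivity) fun u => ?_
  obtain ⟨u, rfl⟩ : ∃ v : Fin m → ℝ, u = WithLp.toLp 2 v := ⟨u.ofLp, rfl⟩
  rw [Matrix.toEuclideanCLM_toLp]
  set w := (empGram m x)⁻¹ *ᵥ u with hw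
  have h1 : empGram m x *ᵥ w = u := by
    rw [hw, Matrix.mulVec_mulVec, Matrix.mul_nonsing_inv _ hdet, Matrix.one_mulVec]
  have h2 := (hx w).1
  rw [h1, ← inner_toEuclidean, ← inner_toEuclidean, real_inner_self_eq_norm_sq] at h2
  have h3 := real_inner_le_norm (WithLp.toLp 2 w : EuclideanSpace ℝ (Fin m)) (WithLp.toLp 2 u)
  rw [one_div_mul_eq_div, le_div_iff₀ hκ]
  by_contra! hc
  have h4 : 0 < ‖(WithLp.toLp 2 w : EuclideanSpace ℝ (Fin m))‖ := by
    by_contra! h5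
    have := norm_nonneg (WithLp.toLp 2 u : EuclideanSpace ℝ (Fin m))
    nlinarith
  nlinarith

theorem phi_sq_le (k : ℕ) (t : ℝ) : phi k t ^ 2 ≤ 2 := by
  by_cases ht : t ∈ Icc (0 : ℝ) 1
  · rw [phi, indicator_of_mem ht]
    exact trig_sq_le k t
  · rw [phi, indicator_of_notMem ht]
    norm_num

theorem sum_phi_sq_le (m : ℕ) (t : ℝ) : ∑ j : Fin m, phi (j + 1) t ^ 2 ≤ 2 * m := by
  refine (Finset.sum_le_sum fun j _ => phi_sq_le _ t).trans (le_of_eq ?_)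
  simp [mul_comm]

theorem supSq_le (m : ℕ) : supSq m ≤ 2 * m :=
  haveI : Nonempty (Icc (0 : ℝ) 1) := ⟨⟨0, by simp⟩⟩
  ciSup_le fun t => sum_phi_sq_le m t

theorem one_le_supSq {m : ℕ} (hm : 1 ≤ m) : 1 ≤ supSq m := by
  have h1 : BddAbove (range fun t : Icc (0 : ℝ) 1 => ∑ j : Fin m, phi (j + 1) (t : ℝ) ^ 2) := by
    refine ⟨2 * m, ?_⟩
    rintro _ ⟨t, rfl⟩
    exact sum_phi_sq_le m t
  refine le_trans ?_ (le_ciSup h1 ⟨0, by simp⟩)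
  refine le_trans (le_of_eq ?_) (Finset.single_le_sum
    (f := fun j : Fin m => phi ((j : ℕ) + 1) (0 : ℝ) ^ 2) (fun j _ => sq_nonneg _)
    (Finset.mem_univ ⟨0, hm⟩))
  simp [phi, trig]

theorem cutoffConst_pos : 0 < cutoffConst := by
  have h : (1 : ℝ) / 3 < Real.log (3 / 2) := by
    rw [Real.lt_log_iff_exp_lt (by norm_num)]
    have h1 : Real.exp (1 / 3) ^ 3 = Real.exp 1 := by
      rw [← Real.exp_nat_mul]
      norm_num
    have h2 := Real.exp_one_lt_d9
    by_contra! hc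
    have h3 : (3 / 2 : ℝ) ^ 3 ≤ Real.exp (1 / 3) ^ 3 := pow_le_pow_left₀ (by norm_num) hc 3
    rw [h1] at h3
    norm_num at h3
    linarith
  unfold cutoffConst
  linarith

theorem cutoffConst_le : cutoffConst ≤ 1 / 2 := by
  have := Real.log_le_sub_one_of_pos (show (0 : ℝ) < 3 / 2 by norm_num)
  unfold cutoffConst
  linarith

theorem Stable.opNorm_inv_le {m : ℕ} {x : Fin n → ℝ} (hm : 1 ≤ m) (hn : 2 ≤ n)
    (hs : Stable m x) : max (opNorm (empGram m x)⁻¹) 1 ≤ n := by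
  have h1 := hs.2
  have h2 : (1 : ℝ) / 2 ≤ Real.log n := by
    have h3 : Real.log 2 ≤ Real.log n :=
      Real.log_le_log (by norm_num) (by exact_mod_cast hn)
    linarith [Real.log_two_gt_d9]
  have hl : (1 : ℝ) ≤ max (opNorm (empGram m x)⁻¹) 1 := le_max_right _ _
  set lam := max (opNorm (empGram m x)⁻¹) 1
  have h3 : lam * (1 / 2) ≤ supSq m * lam * Real.log n := by
    refine mul_le_mul ?_ h2 (by norm_num) ?_
    · exact le_mul_of_one_le_left (by linarith) (one_le_supSq hm)
    · exact mul_nonneg (by linarith [one_le_supSq hm]) (by linarith)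
  have h4 : cutoffConst * n ≤ 1 / 2 * n := mul_le_mul_of_nonneg_right cutoffConst_le (by positivity)
  linarith

theorem GramBounds.one_le_of_not_stable {m : ℕ} {x : Fin n → ℝ} {κ K : ℝ} (hκ : 0 < κ)
    (hn : 1 ≤ n) (hx : GramBounds m x κ K) (hs : ¬ Stable m x) :
    1 ≤ 2 * m * (1 / κ + 1) * Real.log n / (cutoffConst * n) := by
  have hn' : (0 : ℝ) < n := by exact_mod_cast hn
  rw [le_div_iff₀ (mul_pos cutoffConst_pos hn'), one_mul]
  have h1 : ¬ (supSq m * max (opNorm (empGram m x)⁻¹) 1 * Real.log n ≤ cutoffConst * n) :=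
    fun h => hs ⟨hx.isUnit hκ, h⟩
  refine (not_le.1 h1).le.trans ?_
  have h2 : max (opNorm (empGram m x)⁻¹) 1 ≤ 1 / κ + 1 := by
    have : 0 < 1 / κ := by positivity
    exact max_le ((hx.opNorm_inv_le hκ).trans (by linarith)) (by linarith)
  refine mul_le_mul_of_nonneg_right ?_ (Real.log_natCast_nonneg n)
  exact mul_le_mul (supSq_le m) h2 (by positivity) (by positivity)

theorem truncEstimator_one (x y : Fin n → ℝ) (t : ℝ) : truncEstimator 1 x y t = 0 := by
  have h : derivMatrix 1 = 0 := by
    ext j k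
    simp [derivMatrix, derivCoeff]
  simp [truncEstimator, estimator, coeff, h]

theorem error_le_of_not_stable {m : ℕ} {x : Fin n → ℝ} (hs : ¬ Stable m x ∨ m = 1)
    {b' : ℝ → ℝ} {B : ℝ} (hB : 0 ≤ B) (hb : ∀ t ∈ Icc (0 : ℝ) 1, b' t ^ 2 ≤ B) (y : Fin n → ℝ) :
    empNormSq x (fun t => truncEstimator m x y t - b' t) ≤ B := by
  have h : ∀ t, truncEstimator m x y t = 0 := by
    intro t
    rcases hs with hs | rfl
    · simp [truncEstimator, hs]
    · exact truncEstimator_one x y t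
  refine empNormSq_le hB fun t ht => ?_
  rw [h, zero_sub, neg_sq]
  exact hb t ht

end

section

theorem measurable_phi (k : ℕ) : Measurable (phi k) :=
  (continuous_trig k).measurable.indicator measurableSet_Icc

theorem abs_phi_mul_phi_le (j k : ℕ) (t : ℝ) : |phi j t * phi k t| ≤ 2 := by
  rw [abs_mul]
  nlinarith [phi_sq_le j t, phi_sq_le k t, sq_abs (phi j t), sq_abs (phi k t),
    sq_nonneg (|phi j t| - |phi k t|)]

/-- The law with density `f`. -/
def densityLaw (f : ℝ → ℝ) : Measure ℝ := volume.withDensity fun x => ENNReal.ofReal (f x)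

theorem integral_indicator_densityLaw {f : ℝ → ℝ} (hf : Measurable f) (hf0 : ∀ x, 0 ≤ f x)
    (g : ℝ → ℝ) :
    ∫ x, (Icc (0 : ℝ) 1).indicator g x ∂(densityLaw f) = ∫ x in (0 : ℝ)..1, f x * g x := by
  rw [densityLaw, integral_withDensity_eq_integral_toReal_smul hf.ennreal_ofReal
    (Filter.Eventually.of_forall fun x => ENNReal.ofReal_lt_top),
    intervalIntegral.integral_of_le zero_le_one, ← integral_Icc_eq_integral_Ioc,
    ← integral_indicator measurableSet_Icc]
  congr 1
  funext x
  rw [ENNReal.toReal_ofReal (hf0 x), smul_eq_mul]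
  by_cases hx : x ∈ Icc (0 : ℝ) 1
  · simp only [indicator_of_mem hx]
  · simp only [indicator_of_notMem hx, mul_zero]

theorem intervalIntegrable_density_mul {f : ℝ → ℝ} (hf : Measurable f) {f₀ f₁ : ℝ}
    (hf01 : ∀ x ∈ Icc (0 : ℝ) 1, f₀ ≤ f x ∧ f x ≤ f₁) {g : ℝ → ℝ}
    (hg : ContinuousOn g (Icc 0 1)) :
    IntervalIntegrable (fun x => f x * g x) volume 0 1 := by
  rw [intervalIntegrable_iff_integrableOn_Ioc_of_le zero_le_one]
  have h1 : IntegrableOn g (Ioc 0 1) := (intervalIntegrable_of_continuousOn_Icc hg).1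
  refine Integrable.bdd_mul (c := max |f₀| |f₁|) h1 hf.aestronglyMeasurable.restrict ?_
  refine (ae_restrict_iff' measurableSet_Ioc).2 (Filter.Eventually.of_forall fun x hx => ?_)
  have := hf01 x (Ioc_subset_Icc_self hx)
  rw [Real.norm_eq_abs]
  exact abs_le_max_abs_abs this.1 this.2

theorem integral_indicator_densityLaw_le {f : ℝ → ℝ} (hf : Measurable f) (hf0 : ∀ x, 0 ≤ f x)
    {f₀ f₁ : ℝ} (hf01 : ∀ x ∈ Icc (0 : ℝ) 1, f₀ ≤ f x ∧ f x ≤ f₁) {g : ℝ → ℝ}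
    (hg : ContinuousOn g (Icc 0 1)) (hg0 : ∀ x, 0 ≤ g x) :
    ∫ x, (Icc (0 : ℝ) 1).indicator g x ∂(densityLaw f) ≤ f₁ * ∫ x in (0 : ℝ)..1, g x := by
  rw [integral_indicator_densityLaw hf hf0, ← intervalIntegral.integral_const_mul]
  exact intervalIntegral.integral_mono_on zero_le_one (intervalIntegrable_density_mul hf hf01 hg)
    (intervalIntegrable_of_continuousOn_Icc (continuousOn_const.mul hg))
    fun x hx => mul_le_mul_of_nonneg_right (hf01 x hx).2 (hg0 x)

theorem le_integral_indicator_densityLaw {f : ℝ → ℝ} (hf : Measurable f) (hf0 : ∀ x, 0 ≤ f x)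
    {f₀ f₁ : ℝ} (hf01 : ∀ x ∈ Icc (0 : ℝ) 1, f₀ ≤ f x ∧ f x ≤ f₁) {g : ℝ → ℝ}
    (hg : ContinuousOn g (Icc 0 1)) (hg0 : ∀ x, 0 ≤ g x) :
    f₀ * ∫ x in (0 : ℝ)..1, g x ≤ ∫ x, (Icc (0 : ℝ) 1).indicator g x ∂(densityLaw f) := by
  rw [integral_indicator_densityLaw hf hf0, ← intervalIntegral.integral_const_mul]
  exact intervalIntegral.integral_mono_on zero_le_one
    (intervalIntegrable_of_continuousOn_Icc (continuousOn_const.mul hg))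
    (intervalIntegrable_density_mul hf hf01 hg)
    fun x hx => mul_le_mul_of_nonneg_right (hf01 x hx).1 (hg0 x)

/-- The theoretical Gram matrix of the basis. -/
def gram (ρ : Measure ℝ) (m : ℕ) : Matrix (Fin m) (Fin m) ℝ :=
  Matrix.of fun j k => ∫ t, phi (j + 1) t * phi (k + 1) t ∂ρ

theorem dotProduct_gram (ρ : Measure ℝ) [IsProbabilityMeasure ρ] (m : ℕ) (v : Fin m → ℝ) :
    v ⬝ᵥ (gram ρ m *ᵥ v)
      = ∫ t, (Icc (0 : ℝ) 1).indicator (fun t => trigSum m v t ^ 2) t ∂ρ := by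
  have hint : ∀ j k : Fin m, Integrable (fun t => phi (j + 1) t * phi (k + 1) t) ρ := fun j k =>
    Integrable.of_bound ((measurable_phi _).mul (measurable_phi _)).aestronglyMeasurable 2
      (Filter.Eventually.of_forall fun t => abs_phi_mul_phi_le _ _ t)
  have h1 : ∀ t, (Icc (0 : ℝ) 1).indicator (fun t => trigSum m v t ^ 2) t
      = ∑ j : Fin m, ∑ k : Fin m, v j * v k * (phi (j + 1) t * phi (k + 1) t) := by
    intro t
    have h2 : (Icc (0 : ℝ) 1).indicator (fun t => trigSum m v t ^ 2) t
        = ((Icc (0 : ℝ) 1).indicator (trigSum m v) t) ^ 2 := by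
      by_cases ht : t ∈ Icc (0 : ℝ) 1
      · simp only [indicator_of_mem ht]
      · simp [indicator_of_notMem ht]
    rw [h2, indicator_trigSum, sq, Finset.sum_mul_sum]
    exact Finset.sum_congr rfl fun j _ => Finset.sum_congr rfl fun k _ => by ring
  simp only [h1]
  rw [integral_finsetSum _ fun j _ => integrable_finsetSum _ fun k _ => (hint j k).const_mul _]
  simp only [dotProduct, Matrix.mulVec, gram, Matrix.of_apply, Finset.mul_sum]
  refine Finset.sum_congr rfl fun j _ => ?_
  rw [integral_finsetSum _ fun k _ => (hint j k).const_mul _]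
  refine Finset.sum_congr rfl fun k _ => ?_
  rw [integral_const_mul]
  ring

theorem gram_bounds {f : ℝ → ℝ} (hf : Measurable f) (hf0 : ∀ x, 0 ≤ f x)
    {f₀ f₁ : ℝ} (hf01 : ∀ x ∈ Icc (0 : ℝ) 1, f₀ ≤ f x ∧ f x ≤ f₁)
    [IsProbabilityMeasure (densityLaw f)] (m : ℕ) (v : Fin m → ℝ) :
    f₀ * (v ⬝ᵥ v) ≤ v ⬝ᵥ (gram (densityLaw f) m *ᵥ v) ∧
      v ⬝ᵥ (gram (densityLaw f) m *ᵥ v) ≤ f₁ * (v ⬝ᵥ v) := by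
  have h1 : v ⬝ᵥ v = ∫ x in (0 : ℝ)..1, trigSum m v x ^ 2 := by
    rw [integral_trigSum_sq]
    exact Finset.sum_congr rfl fun _ _ => (sq _).symm
  rw [dotProduct_gram, h1]
  exact ⟨le_integral_indicator_densityLaw hf hf0 hf01 ((continuous_trigSum m v).pow 2).continuousOn
      fun x => sq_nonneg _,
    integral_indicator_densityLaw_le hf hf0 hf01 ((continuous_trigSum m v).pow 2).continuousOn
      fun x => sq_nonneg _⟩

variable {n : ℕ}

/-- The entries of the empirical Gram matrix are close to those of the theoretical one. -/
def GramClose (ρ : Measure ℝ) (m : ℕ) (δ : ℝ) (x : Fin n → ℝ) : Prop :=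
  ∀ j k, |empGram m x j k - gram ρ m j k| ≤ δ

theorem empGram_apply (m : ℕ) (x : Fin n → ℝ) (j k : Fin m) :
    empGram m x j k = (1 / (n : ℝ)) * ∑ i, phi (j + 1) (x i) * phi (k + 1) (x i) := by
  simp [empGram, Matrix.mul_apply, designMatrix]

theorem abs_dotProduct_mulVec_le {m : ℕ} {A : Matrix (Fin m) (Fin m) ℝ} {δ : ℝ}
    (hA : ∀ j k, |A j k| ≤ δ) (v : Fin m → ℝ) : |v ⬝ᵥ (A *ᵥ v)| ≤ δ * m * (v ⬝ᵥ v) := by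
  rcases Nat.eq_zero_or_pos m with rfl | hm
  · simp [dotProduct]
  have hδ : 0 ≤ δ := (abs_nonneg _).trans (hA ⟨0, hm⟩ ⟨0, hm⟩)
  have h1 : |v ⬝ᵥ (A *ᵥ v)| ≤ δ * (∑ j, |v j|) ^ 2 := by
    simp only [dotProduct, Matrix.mulVec, Finset.mul_sum]
    refine (Finset.abs_sum_le_sum_abs _ _).trans ?_
    rw [sq, Finset.sum_mul_sum, Finset.mul_sum]
    refine Finset.sum_le_sum fun j _ => (Finset.abs_sum_le_sum_abs _ _).trans ?_
    rw [Finset.mul_sum]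
    refine Finset.sum_le_sum fun k _ => ?_
    rw [abs_mul, abs_mul]
    nlinarith [hA j k, mul_nonneg (abs_nonneg (v j)) (abs_nonneg (v k)),
      mul_le_mul_of_nonneg_right (hA j k) (mul_nonneg (abs_nonneg (v j)) (abs_nonneg (v k)))]
  have h2 : (∑ j, |v j|) ^ 2 ≤ m * (v ⬝ᵥ v) := by
    have := sq_sum_le_card_mul_sum_sq (s := (Finset.univ : Finset (Fin m))) (f := fun j => |v j|)
    simp only [Finset.card_univ, Fintype.card_fin, sq_abs] at this
    refine this.trans (le_of_eq ?_)
    congr 1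
    exact Finset.sum_congr rfl fun _ _ => sq _
  calc |v ⬝ᵥ (A *ᵥ v)| ≤ δ * (∑ j, |v j|) ^ 2 := h1
    _ ≤ δ * (m * (v ⬝ᵥ v)) := mul_le_mul_of_nonneg_left h2 hδ
    _ = δ * m * (v ⬝ᵥ v) := by ring

theorem GramClose.gramBounds {f : ℝ → ℝ} (hf : Measurable f) (hf0 : ∀ x, 0 ≤ f x)
    {f₀ f₁ : ℝ} (hf₀ : 0 < f₀) (hf01 : ∀ x ∈ Icc (0 : ℝ) 1, f₀ ≤ f x ∧ f x ≤ f₁)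
    [IsProbabilityMeasure (densityLaw f)] {m : ℕ} (hm : 1 ≤ m) {x : Fin n → ℝ}
    (hx : GramClose (densityLaw f) m (f₀ / (2 * m)) x) :
    GramBounds m x (f₀ / 2) (f₁ + f₀) := by
  intro v
  have hm' : (0 : ℝ) < m := by exact_mod_cast hm
  have h1 := gram_bounds hf hf0 hf01 m v
  have h2 := abs_le.1 (abs_dotProduct_mulVec_le (A := empGram m x - gram (densityLaw f) m)
    (δ := f₀ / (2 * m)) (fun j k => hx j k) v)
  rw [Matrix.sub_mulVec, dotProduct_sub] at h2
  have h3 : f₀ / (2 * m) * m * (v ⬝ᵥ v) = f₀ / 2 * (v ⬝ᵥ v) := by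
    field_simp
  rw [h3] at h2
  have h4 : 0 ≤ v ⬝ᵥ v := Finset.sum_nonneg fun i _ => mul_self_nonneg _
  constructor
  · linarith [h2.1]
  · nlinarith [h2.2]

variable {Ω : Type*} [MeasurableSpace Ω] {μ : Measure Ω}

theorem gram_eq {ρ : Measure ℝ} {m : ℕ} {Z : Ω → ℝ} (hZ : Measurable Z) (hρ : μ.map Z = ρ)
    (j k : Fin m) : gram ρ m j k = ∫ ω, phi (j + 1) (Z ω) * phi (k + 1) (Z ω) ∂μ := by
  rw [gram, Matrix.of_apply, ← hρ, integral_map hZ.aemeasurable]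
  exact ((measurable_phi _).mul (measurable_phi _)).aestronglyMeasurable

/-- **Hoeffding's inequality** for the mean of bounded independent variables with a common mean. -/
theorem measureReal_abs_mean_sub_gt_le [IsProbabilityMeasure μ] (hn : 1 ≤ n) {Z : Fin n → Ω → ℝ}
    (hZ : ∀ i, Measurable (Z i)) (hind : iIndepFun Z μ) (hb : ∀ i ω, |Z i ω| ≤ 2) {c δ : ℝ}
    (hδ : 0 ≤ δ) (hc : ∀ i, ∫ ω, Z i ω ∂μ = c) :
    μ.real {ω | δ < |(1 / (n : ℝ)) * (∑ i, Z i ω) - c|} ≤ 2 * Real.exp (-(n * δ ^ 2 / 8)) := by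
  have hn' : (0 : ℝ) < n := by exact_mod_cast hn
  have hmem : ∀ i, ∀ᵐ ω ∂μ, Z i ω ∈ Icc (-2 : ℝ) 2 := fun i =>
    Filter.Eventually.of_forall fun ω => abs_le.1 (hb i ω)
  have hsub : ∀ i, HasSubgaussianMGF (fun ω => Z i ω - c) ((‖(2 : ℝ) - -2‖₊ / 2) ^ 2) μ := by
    intro i
    have := hasSubgaussianMGF_of_mem_Icc (hZ i).aemeasurable (hmem i)
    rwa [hc i] at this
  have hcc : ((((‖(2 : ℝ) - -2‖₊ / 2) ^ 2 : NNReal)) : ℝ) = 4 := by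
    push_cast
    rw [Real.norm_eq_abs]
    norm_num
  have hi1 : iIndepFun (fun i ω => Z i ω - c) μ :=
    hind.comp (fun _ z => z - c) fun _ => measurable_id.sub_const c
  have hi2 : iIndepFun (fun i ω => -(Z i ω - c)) μ :=
    hi1.comp (fun _ z => -z) fun _ => measurable_neg
  have h1 := HasSubgaussianMGF.measure_sum_ge_le_of_iIndepFun hi1 (s := Finset.univ)
    (fun i _ => hsub i) (ε := n * δ) (by positivity)
  have h2 := HasSubgaussianMGF.measure_sum_ge_le_of_iIndepFun hi2 (s := Finset.univ)
    (fun i _ => (hsub i).neg) (ε := n * δ) (by positivity)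
  have hexp : -(n * δ) ^ 2 / (2 * ((∑ _i : Fin n, (‖(2 : ℝ) - -2‖₊ / 2) ^ 2 : NNReal) : ℝ))
      = -(n * δ ^ 2 / 8) := by
    rw [NNReal.coe_sum, hcc]
    simp only [Finset.sum_const, Finset.card_univ, Fintype.card_fin, nsmul_eq_mul]
    field_simp
    ring
  rw [hexp] at h1 h2
  have hsubset : {ω | δ < |(1 / (n : ℝ)) * (∑ i, Z i ω) - c|}
      ⊆ {ω | n * δ ≤ ∑ i, (Z i ω - c)} ∪ {ω | n * δ ≤ ∑ i, -(Z i ω - c)} := by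
    intro ω hω
    simp only [mem_ofPred_eq, mem_union, Finset.sum_neg_distrib, Finset.sum_sub_distrib,
      Finset.sum_const, Finset.card_univ, Fintype.card_fin, nsmul_eq_mul] at hω ⊢
    have h3 : (1 / (n : ℝ)) * (∑ i, Z i ω) - c = (1 / (n : ℝ)) * ((∑ i, Z i ω) - n * c) := by
      field_simp
    rw [h3, abs_mul, abs_of_pos (by positivity : 0 < 1 / (n : ℝ)), one_div, ← div_eq_inv_mul,
      lt_div_iff₀ hn'] at hω
    rcases lt_abs.1 hω with h | h
    · left
      linarith
    · right
      linarith
  calc _ ≤ μ.real ({ω | n * δ ≤ ∑ i, (Z i ω - c)} ∪ {ω | n * δ ≤ ∑ i, -(Z i ω - c)}) :=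
        measureReal_mono hsubset
    _ ≤ _ := (measureReal_union_le _ _).trans (by linarith)

theorem measureReal_not_gramClose_le [IsProbabilityMeasure μ] (hn : 1 ≤ n) {X : Fin n → Ω → ℝ}
    (hX : ∀ i, Measurable (X i)) (hind : iIndepFun X μ) {ρ : Measure ℝ}
    (hρ : ∀ i, μ.map (X i) = ρ) (m : ℕ) {δ : ℝ} (hδ : 0 ≤ δ) :
    μ.real {ω | ¬ GramClose ρ m δ fun i => X i ω}
      ≤ 2 * (m : ℝ) ^ 2 * Real.exp (-(n * δ ^ 2 / 8)) := by
  have h1 : {ω | ¬ GramClose ρ m δ fun i => X i ω} = ⋃ p : Fin m × Fin m,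
      {ω | δ < |(1 / (n : ℝ)) * (∑ i, phi (p.1 + 1) (X i ω) * phi (p.2 + 1) (X i ω))
        - gram ρ m p.1 p.2|} := by
    ext ω
    simp [GramClose, empGram_apply]
  rw [h1]
  refine (measureReal_iUnion_fintype_le _).trans ?_
  have h2 : ∀ p : Fin m × Fin m, μ.real {ω | δ < |(1 / (n : ℝ))
      * (∑ i, phi (p.1 + 1) (X i ω) * phi (p.2 + 1) (X i ω)) - gram ρ m p.1 p.2|}
      ≤ 2 * Real.exp (-(n * δ ^ 2 / 8)) := by
    intro p
    have hp : Measurable fun t => phi ((p.1 : ℕ) + 1) t * phi ((p.2 : ℕ) + 1) t :=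
      (measurable_phi _).mul (measurable_phi _)
    exact measureReal_abs_mean_sub_gt_le hn (fun i => hp.comp (hX i)) (hind.comp _ fun _ => hp)
      (fun i ω => abs_phi_mul_phi_le _ _ _) hδ fun i => (gram_eq (hX i) (hρ i) p.1 p.2).symm
  refine (Finset.sum_le_sum fun p _ => h2 p).trans (le_of_eq ?_)
  simp only [Finset.sum_const, Finset.card_univ, Fintype.card_prod, Fintype.card_fin, nsmul_eq_mul]
  push_cast
  ring

end

section

section Measurability

variable {S : Type*} [MeasurableSpace S] {n m : ℕ}

theorem measurable_det {A : S → Matrix (Fin m) (Fin m) ℝ} (hA : ∀ j k, Measurable fun z => A z j k) :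
    Measurable fun z => (A z).det := by
  simp only [Matrix.det_apply']
  exact Finset.measurable_fun_sum _ fun s _ =>
    measurable_const.mul (Finset.measurable_fun_prod _ fun i _ => hA _ _)

theorem measurable_inv_apply {A : S → Matrix (Fin m) (Fin m) ℝ}
    (hA : ∀ j k, Measurable fun z => A z j k) (j k : Fin m) :
    Measurable fun z => (A z)⁻¹ j k := by
  simp only [Matrix.inv_def, Ring.inverse_eq_inv', Matrix.smul_apply, smul_eq_mul,
    Matrix.adjugate_apply]
  refine (measurable_det hA).inv.mul (measurable_det fun i l => ?_)
  simp only [Matrix.updateRow_apply]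
  split_ifs
  · exact measurable_const
  · exact hA i l

theorem continuous_opNorm (m : ℕ) :
    Continuous fun A : Fin m → Fin m → ℝ => opNorm (Matrix.of A) := by
  let T : (Fin m → Fin m → ℝ) →ₗ[ℝ] (EuclideanSpace ℝ (Fin m) →L[ℝ] EuclideanSpace ℝ (Fin m)) :=
    { toFun := fun A => Matrix.toEuclideanCLM (𝕜 := ℝ) (Matrix.of A)
      map_add' := fun A B => map_add (Matrix.toEuclideanCLM (𝕜 := ℝ)) (Matrix.of A) (Matrix.of B)
      map_smul' := fun c A => map_smul (Matrix.toEuclideanCLM (𝕜 := ℝ)) c (Matrix.of A) }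
  exact T.continuous_of_finiteDimensional.norm

theorem measurable_opNorm {A : S → Matrix (Fin m) (Fin m) ℝ}
    (hA : ∀ j k, Measurable fun z => A z j k) : Measurable fun z => opNorm (A z) :=
  (continuous_opNorm m).measurable.comp
    (measurable_pi_lambda (fun z => A z) fun j => measurable_pi_lambda _ fun k => hA j k)

variable {x : S → Fin n → ℝ}

theorem measurable_empGram (hx : Measurable x) (j k : Fin m) :
    Measurable fun z => empGram m (x z) j k := by
  simp only [empGram_apply]
  have h : ∀ i, Measurable fun z => x z i := fun i => (measurable_pi_apply i).comp hx
  exact measurable_const.mul (Finset.measurable_fun_sum _ fun i _ =>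
    ((measurable_phi _).comp (h i)).mul ((measurable_phi _).comp (h i)))

theorem measurableSet_stable (hx : Measurable x) : MeasurableSet {z | Stable m (x z)} := by
  have h1 := measurable_empGram (m := m) hx
  have h2 : {z | Stable m (x z)} = {z | (empGram m (x z)).det ≠ 0}
      ∩ {z | supSq m * max (opNorm (empGram m (x z))⁻¹) 1 * Real.log n ≤ cutoffConst * n} := by
    ext z
    simp [Stable, Matrix.isUnit_iff_isUnit_det]
  rw [h2]
  refine MeasurableSet.inter ((measurable_det h1) (measurableSet_singleton 0).compl) ?_
  exact measurableSet_le ((measurable_const.mul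
    ((measurable_opNorm (measurable_inv_apply h1)).max measurable_const)).mul_const _)
    measurable_const

theorem measurableSet_gramClose (hx : Measurable x) (ρ : Measure ℝ) (δ : ℝ) :
    MeasurableSet {z | GramClose ρ m δ (x z)} := by
  have h2 : {z | GramClose ρ m δ (x z)}
      = ⋂ j, ⋂ k, {z | |empGram m (x z) j k - gram ρ m j k| ≤ δ} := by
    ext z
    simp [GramClose]
  rw [h2]
  refine MeasurableSet.iInter fun j => MeasurableSet.iInter fun k => ?_
  exact measurableSet_le (((measurable_empGram hx j k).sub_const _).abs) measurable_const

theorem measurable_lsMatrix (hx : Measurable x) (j : Fin m) (i : Fin n) :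
    Measurable fun z => lsMatrix m (x z) j i := by
  simp only [lsMatrix, Matrix.mul_apply, Matrix.smul_apply, Matrix.transpose_apply, designMatrix,
    Matrix.of_apply, smul_eq_mul]
  exact Finset.measurable_fun_sum _ fun k _ =>
    (measurable_inv_apply (measurable_empGram hx) j k).mul
      (measurable_const.mul ((measurable_phi _).comp ((measurable_pi_apply i).comp hx)))

theorem measurable_indicator_Icc {g : ℝ → ℝ} (hg : ContinuousOn g (Icc 0 1)) :
    Measurable ((Icc (0 : ℝ) 1).indicator g) := by
  classical
  have := ContinuousOn.measurable_piecewise hg (continuousOn_const (c := (0 : ℝ)))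
    measurableSet_Icc
  rwa [← piecewise_eq_indicator]

theorem measurable_truncEstimator (hx : Measurable x) {y : S → Fin n → ℝ} (hy : Measurable y)
    {t : S → ℝ} (ht : Measurable t) :
    Measurable fun z => truncEstimator m (x z) (y z) (t z) := by
  classical
  have h : Measurable fun z => estimator m (x z) (y z) (t z) := by
    simp only [estimator, coeff_eq, Matrix.mulVec, dotProduct]
    exact Finset.measurable_fun_sum _ fun j _ => Measurable.mul
      (Finset.measurable_fun_sum _ fun k _ => measurable_const.mul
        (Finset.measurable_fun_sum _ fun i _ => (measurable_lsMatrix hx k i).mul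
          ((measurable_pi_apply i).comp hy))) ((measurable_phi _).comp ht)
  exact Measurable.ite (measurableSet_stable hx) h measurable_const

theorem truncEstimator_congr {x y z : Fin n → ℝ} (h : ∀ i, x i ∈ Icc (0 : ℝ) 1 → y i = z i) :
    truncEstimator m x y = truncEstimator m x z := by
  funext t
  simp only [truncEstimator, estimator, coeff_eq, lsMatrix_mulVec_congr h]

theorem truncEstimator_of_notMem {x y : Fin n → ℝ} {t : ℝ} (ht : t ∉ Icc (0 : ℝ) 1) :
    truncEstimator m x y t = 0 := by
  simp [truncEstimator, estimator, phi, indicator_of_notMem ht]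

theorem measurable_error (hx : Measurable x) {e : S → Fin n → ℝ} (he : Measurable e)
    {b b' : ℝ → ℝ} (hb : ContinuousOn b (Icc 0 1)) (hb' : ContinuousOn b' (Icc 0 1)) :
    Measurable fun z => empNormSq (x z)
      fun t => truncEstimator m (x z) (fun i => b (x z i) + e z i) t - b' t := by
  have hxi : ∀ i, Measurable fun z => x z i := fun i => (measurable_pi_apply i).comp hx
  have h1 : ∀ z i, (Icc (0 : ℝ) 1).indicator
      (fun t => truncEstimator m (x z) (fun i => b (x z i) + e z i) t - b' t) (x z i)
      = truncEstimator m (x z) (fun i => (Icc (0 : ℝ) 1).indicator b (x z i) + e z i) (x z i)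
        - (Icc (0 : ℝ) 1).indicator b' (x z i) := by
    intro z i
    rw [truncEstimator_congr (y := fun i => b (x z i) + e z i)
      (z := fun i => (Icc (0 : ℝ) 1).indicator b (x z i) + e z i)
      fun i hi => by rw [indicator_of_mem hi]]
    by_cases hi : x z i ∈ Icc (0 : ℝ) 1
    · simp only [indicator_of_mem hi]
    · simp only [indicator_of_notMem hi, truncEstimator_of_notMem hi, sub_zero]
  simp only [empNormSq, h1]
  refine measurable_const.mul (Finset.measurable_fun_sum _ fun i _ => Measurable.pow_const ?_ 2)
  refine (measurable_truncEstimator hx ?_ (hxi i)).sub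
    ((measurable_indicator_Icc hb').comp (hxi i))
  exact measurable_pi_lambda _ fun i => ((measurable_indicator_Icc hb).comp (hxi i)).add
    ((measurable_pi_apply i).comp he)

end Measurability

variable {n : ℕ}

/-- A noise vector with uncorrelated components of variance `σ²`. -/
def WhiteNoise (ν : Measure (Fin n → ℝ)) (σ : ℝ) : Prop :=
  ∀ i j, Integrable (fun e => e i * e j) ν ∧ ∫ e, e i * e j ∂ν = if i = j then σ ^ 2 else 0

theorem WhiteNoise.integral_mulVec {ν : Measure (Fin n → ℝ)} {σ : ℝ} (hν : WhiteNoise ν σ) {m : ℕ}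
    (M : Matrix (Fin m) (Fin n) ℝ) :
    Integrable (fun e => (M *ᵥ e) ⬝ᵥ (M *ᵥ e)) ν ∧
      ∫ e, (M *ᵥ e) ⬝ᵥ (M *ᵥ e) ∂ν = σ ^ 2 * ∑ j, ∑ i, M j i ^ 2 := by
  have h1 : ∀ e : Fin n → ℝ, (M *ᵥ e) ⬝ᵥ (M *ᵥ e)
      = ∑ j, ∑ i, ∑ k, M j i * M j k * (e i * e k) := by
    intro e
    simp only [dotProduct, Matrix.mulVec, Finset.sum_mul_sum]
    exact Finset.sum_congr rfl fun j _ => Finset.sum_congr rfl fun i _ =>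
      Finset.sum_congr rfl fun k _ => by ring
  simp only [h1]
  have h2 : ∀ j i k, Integrable (fun e : Fin n → ℝ => M j i * M j k * (e i * e k)) ν :=
    fun j i k => (hν i k).1.const_mul _
  refine ⟨integrable_finsetSum _ fun j _ => integrable_finsetSum _ fun i _ =>
    integrable_finsetSum _ fun k _ => h2 j i k, ?_⟩
  rw [integral_finsetSum _ fun j _ => integrable_finsetSum _ fun i _ =>
    integrable_finsetSum _ fun k _ => h2 j i k, Finset.mul_sum]
  refine Finset.sum_congr rfl fun j _ => ?_
  rw [integral_finsetSum _ fun i _ => integrable_finsetSum _ fun k _ => h2 j i k, Finset.mul_sum]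
  refine Finset.sum_congr rfl fun i _ => ?_
  rw [integral_finsetSum _ fun k _ => h2 j i k]
  simp only [integral_const_mul, (hν i _).2, mul_ite, mul_zero, Finset.sum_ite_eq,
    Finset.mem_univ, if_true]
  ring

theorem whiteNoise_map {Ω : Type*} [MeasurableSpace Ω] {μ : Measure Ω} [IsProbabilityMeasure μ]
    {ε : Fin n → Ω → ℝ} {σ : ℝ} (hε : ∀ i, Measurable (ε i)) (hind : iIndepFun ε μ)
    (h2 : ∀ i, MemLp (ε i) 2 μ) (h0 : ∀ i, ∫ ω, ε i ω ∂μ = 0)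
    (hv : ∀ i, variance (ε i) μ = σ ^ 2) : WhiteNoise (μ.map fun ω i => ε i ω) σ := by
  intro i j
  have hm : AEMeasurable (fun ω i => ε i ω) μ := (measurable_pi_lambda _ hε).aemeasurable
  have hs : Measurable fun e : Fin n → ℝ => e i * e j :=
    (measurable_pi_apply i).mul (measurable_pi_apply j)
  rw [integrable_map_measure hs.aestronglyMeasurable hm, integral_map hm hs.aestronglyMeasurable]
  refine ⟨(h2 i).integrable_mul (h2 j), ?_⟩
  split_ifs with hij
  · subst hij
    rw [← hv i, variance_of_integral_eq_zero (hε i).aemeasurable (h0 i)]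
    exact integral_congr_ae (Filter.Eventually.of_forall fun ω => (sq _).symm)
  · rw [(hind.indepFun hij).integral_fun_mul_eq_mul_integral (hε i).aestronglyMeasurable
      (hε j).aestronglyMeasurable, h0 i, zero_mul]

theorem WhiteNoise.lintegral_le {ν : Measure (Fin n → ℝ)} [IsProbabilityMeasure ν] {σ : ℝ}
    (hν : WhiteNoise ν σ) {m : ℕ} (M : Matrix (Fin m) (Fin n) ℝ) {D : (Fin n → ℝ) → ℝ} {α γ B : ℝ}
    (hα : 0 ≤ α) (hγ : 0 ≤ γ) (hD : ∀ e, D e ≤ α + γ * ((M *ᵥ e) ⬝ᵥ (M *ᵥ e)))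
    (hB : α + γ * (σ ^ 2 * ∑ j, ∑ i, M j i ^ 2) ≤ B) :
    ∫⁻ e, ENNReal.ofReal (D e) ∂ν ≤ ENNReal.ofReal B := by
  obtain ⟨h1, h2⟩ := hν.integral_mulVec M
  have h3 : Integrable (fun e => α + γ * ((M *ᵥ e) ⬝ᵥ (M *ᵥ e))) ν :=
    (integrable_const α).add (h1.const_mul γ)
  refine (lintegral_mono fun e => ENNReal.ofReal_le_ofReal (hD e)).trans ?_
  rw [← ofReal_integral_eq_lintegral_ofReal h3 (Filter.Eventually.of_forall fun e => ?_)]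
  · refine ENNReal.ofReal_le_ofReal (le_trans (le_of_eq ?_) hB)
    rw [integral_add (integrable_const α) (h1.const_mul γ), integral_const_mul, h2]
    simp
  · exact add_nonneg hα (mul_nonneg hγ (Finset.sum_nonneg fun _ _ => mul_self_nonneg _))

/-- Integration of the noise, conditionally on the design. -/
theorem integral_le_of_lintegral_noise_le {Ω : Type*} [MeasurableSpace Ω] {μ : Measure Ω}
    [IsProbabilityMeasure μ] {X ε : Ω → Fin n → ℝ} (hX : Measurable X) (hε : Measurable ε)
    (hind : IndepFun X ε μ) {D : (Fin n → ℝ) × (Fin n → ℝ) → ℝ} (hD : Measurable D)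
    (hD0 : ∀ p, 0 ≤ D p) {B : (Fin n → ℝ) → ℝ} (hB0 : ∀ x, 0 ≤ B x)
    (hDB : ∀ x, ∫⁻ e, ENNReal.ofReal (D (x, e)) ∂(μ.map ε) ≤ ENNReal.ofReal (B x))
    (hB : Integrable (fun ω => B (X ω)) μ) :
    Integrable (fun ω => D (X ω, ε ω)) μ ∧ ∫ ω, D (X ω, ε ω) ∂μ ≤ ∫ ω, B (X ω) ∂μ := by
  have := Measure.isProbabilityMeasure_map (μ := μ) hX.aemeasurable
  have := Measure.isProbabilityMeasure_map (μ := μ) hε.aemeasurable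
  have hm : Measurable fun ω => D (X ω, ε ω) := hD.comp (hX.prodMk hε)
  have h1 : ∫⁻ ω, ENNReal.ofReal (D (X ω, ε ω)) ∂μ ≤ ENNReal.ofReal (∫ ω, B (X ω) ∂μ) := by
    rw [← lintegral_map (μ := μ) (f := fun p => ENNReal.ofReal (D p)) hD.ennreal_ofReal
      (hX.prodMk hε), (indepFun_iff_map_prod_eq_prod_map_map hX.aemeasurable hε.aemeasurable).1 hind,
      lintegral_prod _ hD.ennreal_ofReal.aemeasurable]
    refine (lintegral_mono hDB).trans ((lintegral_map_le _ _).trans (le_of_eq ?_))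
    rw [ofReal_integral_eq_lintegral_ofReal hB (Filter.Eventually.of_forall fun ω => hB0 _)]
  have h2 : Integrable (fun ω => D (X ω, ε ω)) μ := by
    refine ⟨hm.aestronglyMeasurable, ?_⟩
    rw [hasFiniteIntegral_iff_ofReal (Filter.Eventually.of_forall fun ω => hD0 _)]
    exact h1.trans_lt ENNReal.ofReal_lt_top
  refine ⟨h2, ?_⟩
  rw [← ofReal_integral_eq_lintegral_ofReal h2 (Filter.Eventually.of_forall fun ω => hD0 _)] at h1
  exact (ENNReal.ofReal_le_ofReal_iff (integral_nonneg fun ω => hB0 _)).1 h1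

/-- The bound of the error, conditionally on the design. -/
def designBound (m : ℕ) (f₀ f₁ σ L : ℝ) (G : Set (Fin n → ℝ)) (h₀ h₁ : ℝ → ℝ) (x : Fin n → ℝ) : ℝ :=
  2 * empNormSq x h₁ + 128 * (f₁ + f₀) / f₀ * (m : ℝ) ^ 2 * empNormSq x h₀
    + (128 * (f₁ + f₀) / f₀ * (m : ℝ) ^ 2 * (σ ^ 2 * (m / n))
      + L ^ 2 * (2 * m * (1 / (f₀ / 2) + 1) * Real.log n / (cutoffConst * n)))
    + 10368 * (σ ^ 2 + L ^ 2) * (n : ℝ) ^ 4 * Gᶜ.indicator 1 x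

theorem designBound_nonneg {m : ℕ} {f₀ f₁ σ L : ℝ} (hf₀ : 0 < f₀) (hf₁ : 0 ≤ f₁)
    (G : Set (Fin n → ℝ)) (h₀ h₁ : ℝ → ℝ) (x : Fin n → ℝ) :
    0 ≤ designBound m f₀ f₁ σ L G h₀ h₁ x := by
  have h1 := empNormSq_nonneg x h₀
  have h2 := empNormSq_nonneg x h₁
  have h3 := cutoffConst_pos
  have h4 := Real.log_natCast_nonneg n
  have h5 : 0 ≤ Gᶜ.indicator (1 : (Fin n → ℝ) → ℝ) x :=
    indicator_nonneg (fun _ _ => zero_le_one) x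
  unfold designBound
  positivity

theorem WhiteNoise.lintegral_error_le {ν : Measure (Fin n → ℝ)} [IsProbabilityMeasure ν] {σ : ℝ}
    (hν : WhiteNoise ν σ) {m : ℕ} (hn : 1 ≤ n) (hm : 1 ≤ m) (hmn : m ≤ 3 * n)
    (hm1 : n = 1 → m = 1) {f₀ f₁ L : ℝ} (hf₀ : 0 < f₀) (hf₁ : 0 ≤ f₁) {G : Set (Fin n → ℝ)}
    (hG : ∀ x ∈ G, GramBounds m x (f₀ / 2) (f₁ + f₀)) {b b' : ℝ → ℝ} {a : Fin m → ℝ}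
    (hb' : ∀ t ∈ Icc (0 : ℝ) 1, b' t ^ 2 ≤ L ^ 2)
    (hb : ∀ t ∈ Icc (0 : ℝ) 1, (b t - trigSum m a t) ^ 2 ≤ L ^ 2) (x : Fin n → ℝ) :
    ∫⁻ e, ENNReal.ofReal (empNormSq x
      fun t => truncEstimator m x (fun i => b (x i) + e i) t - b' t) ∂ν
      ≤ ENNReal.ofReal (designBound m f₀ f₁ σ L G (fun t => b t - trigSum m a t)
          (fun t => b' t - trigSum m ((derivMatrix m)ᵀ *ᵥ a) t) x) := by
  have hn' : (1 : ℝ) ≤ n := by exact_mod_cast hn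
  have hm' : (1 : ℝ) ≤ m := by exact_mod_cast hm
  have hmn' : (m : ℝ) ≤ 3 * n := by exact_mod_cast hmn
  have hE0 := empNormSq_nonneg x (fun t => b t - trigSum m a t)
  have hE1 := empNormSq_nonneg x (fun t => b' t - trigSum m ((derivMatrix m)ᵀ *ᵥ a) t)
  have hE0' : empNormSq x (fun t => b t - trigSum m a t) ≤ L ^ 2 := empNormSq_le (sq_nonneg L) hb
  have hc := cutoffConst_pos
  have hlog := Real.log_natCast_nonneg n
  set E0 := empNormSq x (fun t => b t - trigSum m a t) with hE0def
  set E1 := empNormSq x (fun t => b' t - trigSum m ((derivMatrix m)ᵀ *ᵥ a) t) with hE1def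
  have hT : 0 ≤ L ^ 2 * (2 * m * (1 / (f₀ / 2) + 1) * Real.log n / (cutoffConst * n)) := by
    positivity
  have hV : 0 ≤ 128 * (f₁ + f₀) / f₀ * (m : ℝ) ^ 2 * (σ ^ 2 * (m / n)) := by positivity
  have hW : 0 ≤ 128 * (f₁ + f₀) / f₀ * (m : ℝ) ^ 2 * E0 := by positivity
  by_cases hx : x ∈ G
  · have hR : Gᶜ.indicator (1 : (Fin n → ℝ) → ℝ) x = 0 := by
      rw [indicator_of_notMem]
      simpa using hx
    have hκ : 0 < f₀ / 2 := by positivity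
    by_cases hs : Stable m x
    · refine hν.lintegral_le (lsMatrix m x)
        (α := 2 * E1 + 64 * (f₁ + f₀) * (m : ℝ) ^ 2 * (E0 / (f₀ / 2)))
        (γ := 64 * (f₁ + f₀) * (m : ℝ) ^ 2) (by positivity) (by positivity)
        (fun e => ((hG x hx).error_le hκ (by positivity) hs a b b' e).trans (le_of_eq (by ring))) ?_
      have h1 := mul_le_mul_of_nonneg_left ((hG x hx).sum_sq_lsMatrix_le hκ hs.1)
        (show 0 ≤ 64 * (f₁ + f₀) * (m : ℝ) ^ 2 * σ ^ 2 by positivity)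
      have h2 : 64 * (f₁ + f₀) * (m : ℝ) ^ 2 * σ ^ 2 * ((m : ℝ) / (f₀ / 2 * n))
          = 128 * (f₁ + f₀) / f₀ * (m : ℝ) ^ 2 * (σ ^ 2 * (m / n)) := by
        field_simp
        ring
      have h3 : 64 * (f₁ + f₀) * (m : ℝ) ^ 2 * (E0 / (f₀ / 2))
          = 128 * (f₁ + f₀) / f₀ * (m : ℝ) ^ 2 * E0 := by
        field_simp
        ring
      rw [h2] at h1
      rw [designBound, ← hE0def, ← hE1def, hR, h3]
      linarith
    · refine hν.lintegral_le (lsMatrix m x) (α := L ^ 2) (γ := 0) (sq_nonneg L) le_rfl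
        (fun e => (error_le_of_not_stable (Or.inl hs) (sq_nonneg L) hb' _).trans (by simp)) ?_
      have h1 := mul_le_mul_of_nonneg_left ((hG x hx).one_le_of_not_stable hκ hn hs) (sq_nonneg L)
      rw [designBound, ← hE0def, ← hE1def, hR]
      linarith
  · have hR : Gᶜ.indicator (1 : (Fin n → ℝ) → ℝ) x = 1 := by
      rw [indicator_of_mem]
      · rfl
      · exact hx
    have hn4 : (1 : ℝ) ≤ (n : ℝ) ^ 4 := one_le_pow₀ hn'
    by_cases hs : ¬ Stable m x ∨ m = 1
    · refine hν.lintegral_le (lsMatrix m x) (α := L ^ 2) (γ := 0) (sq_nonneg L) le_rfl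
        (fun e => (error_le_of_not_stable hs (sq_nonneg L) hb' _).trans (by simp)) ?_
      rw [designBound, ← hE0def, ← hE1def, hR]
      have h1 : L ^ 2 ≤ (σ ^ 2 + L ^ 2) * (n : ℝ) ^ 4 :=
        (le_add_of_nonneg_left (sq_nonneg σ)).trans (le_mul_of_one_le_right (by positivity) hn4)
      have h2 : 0 ≤ L ^ 2 := sq_nonneg L
      linarith
    · have hs1 : Stable m x := by
        by_contra h
        exact hs (Or.inl h)
      have hn2 : 2 ≤ n := by
        by_contra h
        exact hs (Or.inr (hm1 (by omega)))
      have hl := hs1.opNorm_inv_le hm hn2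
      have hgb := gramBounds_of_isUnit hs1.1
      have hl1 : (1 : ℝ) ≤ max (opNorm (empGram m x)⁻¹) 1 := le_max_right _ _
      set lam := max (opNorm (empGram m x)⁻¹) 1
      have hκ : 0 < lam⁻¹ := by positivity
      refine hν.lintegral_le (lsMatrix m x)
        (α := 2 * E1 + 64 * (2 * m) * (m : ℝ) ^ 2 * (E0 / lam⁻¹))
        (γ := 64 * (2 * m) * (m : ℝ) ^ 2) (by positivity) (by positivity)
        (fun e => (hgb.error_le hκ (by positivity) hs1 a b b' e).trans (le_of_eq (by ring))) ?_
      have h1 : E0 / lam⁻¹ ≤ L ^ 2 * n := by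
        rw [div_inv_eq_mul]
        exact mul_le_mul hE0' hl (by positivity) (sq_nonneg L)
      have h2 : ∑ j, ∑ i, lsMatrix m x j i ^ 2 ≤ m := by
        refine (hgb.sum_sq_lsMatrix_le hκ hs1.1).trans ?_
        rw [div_le_iff₀ (by positivity)]
        refine le_mul_of_one_le_right (by positivity) ?_
        rw [← div_eq_inv_mul, le_div_iff₀ (by positivity), one_mul]
        exact hl
      have h3 : E0 / lam⁻¹ + σ ^ 2 * ∑ j, ∑ i, lsMatrix m x j i ^ 2
          ≤ 3 * (σ ^ 2 + L ^ 2) * n := by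
        have h4 := mul_le_mul_of_nonneg_left (h2.trans hmn') (sq_nonneg σ)
        have h5 : 0 ≤ L ^ 2 * (n : ℝ) := by positivity
        linarith
      have h6 : 64 * (2 * m) * (m : ℝ) ^ 2 ≤ 3456 * (n : ℝ) ^ 3 := by
        have : (m : ℝ) ^ 3 ≤ (3 * n) ^ 3 := by gcongr
        linarith [this]
      have h7 := mul_le_mul h6 h3 (by positivity) (by positivity)
      rw [designBound, ← hE0def, ← hE1def, hR]
      linarith

end

section Expectation

variable {n : ℕ} {Ω : Type*} [MeasurableSpace Ω] {μ : Measure Ω} [IsProbabilityMeasure μ]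

theorem integral_empNormSq_le (hn : 1 ≤ n) {X : Fin n → Ω → ℝ} (hX : ∀ i, Measurable (X i))
    {f : ℝ → ℝ} (hf : Measurable f) (hf0 : ∀ x, 0 ≤ f x) (hρ : ∀ i, μ.map (X i) = densityLaw f)
    {f₀ f₁ : ℝ} (hf01 : ∀ x ∈ Icc (0 : ℝ) 1, f₀ ≤ f x ∧ f x ≤ f₁) {h : ℝ → ℝ}
    (hh : ContinuousOn h (Icc 0 1)) :
    Integrable (fun ω => empNormSq (fun i => X i ω) h) μ ∧
      ∫ ω, empNormSq (fun i => X i ω) h ∂μ ≤ f₁ * ∫ x in (0 : ℝ)..1, h x ^ 2 := by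
  have hm : Measurable fun t => ((Icc (0 : ℝ) 1).indicator h t) ^ 2 :=
    (measurable_indicator_Icc hh).pow_const 2
  obtain ⟨C, hC⟩ := isCompact_Icc.exists_bound_of_continuousOn hh
  have hbd : ∀ t, ‖((Icc (0 : ℝ) 1).indicator h t) ^ 2‖ ≤ C ^ 2 := by
    intro t
    rw [norm_pow]
    by_cases ht : t ∈ Icc (0 : ℝ) 1
    · rw [indicator_of_mem ht]
      exact pow_le_pow_left₀ (norm_nonneg _) (hC t ht) 2
    · rw [indicator_of_notMem ht]
      simpa using sq_nonneg C
  have hint : ∀ i, Integrable (fun ω => ((Icc (0 : ℝ) 1).indicator h (X i ω)) ^ 2) μ := fun i =>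
    Integrable.of_bound (hm.comp (hX i)).aestronglyMeasurable (C ^ 2)
      (Filter.Eventually.of_forall fun ω => hbd _)
  have hle : ∀ i, ∫ ω, ((Icc (0 : ℝ) 1).indicator h (X i ω)) ^ 2 ∂μ
      ≤ f₁ * ∫ x in (0 : ℝ)..1, h x ^ 2 := by
    intro i
    rw [← integral_map (f := fun t => ((Icc (0 : ℝ) 1).indicator h t) ^ 2) (hX i).aemeasurable
      hm.aestronglyMeasurable, hρ i]
    have h1 : (fun t => ((Icc (0 : ℝ) 1).indicator h t) ^ 2)
        = (Icc (0 : ℝ) 1).indicator fun t => h t ^ 2 := by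
      funext t
      by_cases ht : t ∈ Icc (0 : ℝ) 1
      · simp only [indicator_of_mem ht]
      · simp [indicator_of_notMem ht]
    rw [h1]
    exact integral_indicator_densityLaw_le hf hf0 hf01 (hh.pow 2) fun x => sq_nonneg _
  unfold empNormSq
  refine ⟨(integrable_finsetSum _ fun i _ => hint i).const_mul _, ?_⟩
  rw [integral_const_mul, integral_finsetSum _ fun i _ => hint i]
  have hn' : (0 : ℝ) < n := by exact_mod_cast hn
  rw [one_div, inv_mul_le_iff₀ hn']
  refine (Finset.sum_le_sum fun i _ => hle i).trans (le_of_eq ?_)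
  rw [Finset.sum_const, Finset.card_univ, Fintype.card_fin, nsmul_eq_mul]

theorem integral_affine_combination {u v w : Ω → ℝ} (hu : Integrable u μ) (hv : Integrable v μ)
    (hw : Integrable w μ) (p q k d : ℝ) :
    Integrable (fun ω => p * u ω + q * v ω + k + d * w ω) μ ∧
      ∫ ω, (p * u ω + q * v ω + k + d * w ω) ∂μ
        = p * (∫ ω, u ω ∂μ) + q * (∫ ω, v ω ∂μ) + k + d * ∫ ω, w ω ∂μ := by
  have h1 : Integrable (fun ω => p * u ω + q * v ω) μ := (hu.const_mul p).add (hv.const_mul q)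
  have h2 : Integrable (fun ω => p * u ω + q * v ω + k) μ := h1.add (integrable_const k)
  refine ⟨h2.add (hw.const_mul d), ?_⟩
  rw [integral_add h2 (hw.const_mul d), integral_add h1 (integrable_const k),
    integral_add (hu.const_mul p) (hv.const_mul q), integral_const_mul, integral_const_mul,
    integral_const_mul, integral_const, probReal_univ, one_smul]

theorem integral_designBound_le (hn : 1 ≤ n) {X : Fin n → Ω → ℝ} (hX : ∀ i, Measurable (X i))
    (hind : iIndepFun X μ)
    {f : ℝ → ℝ} (hf : Measurable f) (hf0 : ∀ x, 0 ≤ f x) (hρ : ∀ i, μ.map (X i) = densityLaw f)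
    {f₀ f₁ : ℝ} (hf₀ : 0 < f₀) (hf₁ : 0 ≤ f₁)
    (hf01 : ∀ x ∈ Icc (0 : ℝ) 1, f₀ ≤ f x ∧ f x ≤ f₁) {h₀ h₁ : ℝ → ℝ}
    (hh₀ : ContinuousOn h₀ (Icc 0 1)) (hh₁ : ContinuousOn h₁ (Icc 0 1)) (σ L : ℝ) (m : ℕ)
    {δ : ℝ} (hδ : 0 ≤ δ) :
    Integrable (fun ω => designBound m f₀ f₁ σ L {x | GramClose (densityLaw f) m δ x} h₀ h₁
      fun i => X i ω) μ ∧
      ∫ ω, designBound m f₀ f₁ σ L {x | GramClose (densityLaw f) m δ x} h₀ h₁ (fun i => X i ω) ∂μ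
        ≤ 2 * (f₁ * ∫ x in (0 : ℝ)..1, h₁ x ^ 2)
          + 128 * (f₁ + f₀) / f₀ * (m : ℝ) ^ 2 * (f₁ * ∫ x in (0 : ℝ)..1, h₀ x ^ 2)
          + (128 * (f₁ + f₀) / f₀ * (m : ℝ) ^ 2 * (σ ^ 2 * (m / n))
            + L ^ 2 * (2 * m * (1 / (f₀ / 2) + 1) * Real.log n / (cutoffConst * n)))
          + 10368 * (σ ^ 2 + L ^ 2) * (n : ℝ) ^ 4
            * (2 * (m : ℝ) ^ 2 * Real.exp (-(n * δ ^ 2 / 8))) := by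
  obtain ⟨i0, l0⟩ := integral_empNormSq_le hn hX hf hf0 hρ hf01 hh₀
  obtain ⟨i1, l1⟩ := integral_empNormSq_le hn hX hf hf0 hρ hf01 hh₁
  have hXm : Measurable fun ω i => X i ω := measurable_pi_lambda _ hX
  set E : Set Ω := {ω | ¬ GramClose (densityLaw f) m δ fun i => X i ω} with hE
  have hEm : MeasurableSet E := (measurableSet_gramClose hXm (densityLaw f) δ).compl
  have hP : μ.real E ≤ 2 * (m : ℝ) ^ 2 * Real.exp (-(n * δ ^ 2 / 8)) :=
    measureReal_not_gramClose_le hn hX hind hρ m hδ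
  have iE : Integrable (E.indicator (1 : Ω → ℝ)) μ :=
    (integrable_const (1 : ℝ)).indicator hEm
  have lE : ∫ ω, E.indicator (1 : Ω → ℝ) ω ∂μ = μ.real E := integral_indicator_one hEm
  have key : (fun ω => designBound m f₀ f₁ σ L {x | GramClose (densityLaw f) m δ x} h₀ h₁
      fun i => X i ω) = fun ω => 2 * empNormSq (fun i => X i ω) h₁
        + 128 * (f₁ + f₀) / f₀ * (m : ℝ) ^ 2 * empNormSq (fun i => X i ω) h₀
        + (128 * (f₁ + f₀) / f₀ * (m : ℝ) ^ 2 * (σ ^ 2 * (m / n))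
          + L ^ 2 * (2 * m * (1 / (f₀ / 2) + 1) * Real.log n / (cutoffConst * n)))
        + 10368 * (σ ^ 2 + L ^ 2) * (n : ℝ) ^ 4 * E.indicator (1 : Ω → ℝ) ω := rfl
  rw [key]
  obtain ⟨hI, hI'⟩ := integral_affine_combination i1 i0 iE 2
    (128 * (f₁ + f₀) / f₀ * (m : ℝ) ^ 2) (128 * (f₁ + f₀) / f₀ * (m : ℝ) ^ 2 * (σ ^ 2 * (m / n))
      + L ^ 2 * (2 * m * (1 / (f₀ / 2) + 1) * Real.log n / (cutoffConst * n)))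
    (10368 * (σ ^ 2 + L ^ 2) * (n : ℝ) ^ 4)
  refine ⟨hI, ?_⟩
  rw [hI', lE]
  have k1 := mul_le_mul_of_nonneg_left l1 (show (0 : ℝ) ≤ 2 by norm_num)
  have k0 := mul_le_mul_of_nonneg_left l0
    (show 0 ≤ 128 * (f₁ + f₀) / f₀ * (m : ℝ) ^ 2 by positivity)
  have kE := mul_le_mul_of_nonneg_left hP
    (show 0 ≤ 10368 * (σ ^ 2 + L ^ 2) * (n : ℝ) ^ 4 by positivity)
  linarith

end Expectation

section Rates

variable {β n m : ℕ} {s : ℝ}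

theorem exp_neg_le (y : ℝ) (hy : 0 < y) : Real.exp (-y) ≤ 362880 / y ^ 9 := by
  have h := Real.pow_div_factorial_le_exp y hy.le 9
  rw [show ((Nat.factorial 9 : ℕ) : ℝ) = 362880 by norm_num [Nat.factorial]] at h
  rw [Real.exp_neg, inv_eq_one_div, div_le_div_iff₀ (Real.exp_pos y) (by positivity), one_mul]
  rwa [div_le_iff₀ (by norm_num), mul_comm] at h

theorem inv_pow_le_rate (hβ : 1 < β) (hs : 1 ≤ s) (hn : s ^ (2 * β + 1) = n) (hsm : s ≤ 3 * m)
    {I L : ℝ} (hI : (m : ℝ) ^ (2 * (β - 1)) * I ≤ L ^ 2) :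
    I ≤ L ^ 2 * 3 ^ (2 * (β - 1)) * (s ^ 3 / n) := by
  have hs0 : 0 < s := by linarith
  have hm0 : 0 < (m : ℝ) := by linarith
  have h1 : s ^ 3 / n = (s ^ (2 * (β - 1)))⁻¹ := by
    rw [← hn, show 2 * β + 1 = 3 + 2 * (β - 1) by omega, pow_add]
    field_simp
  rw [h1, ← div_eq_mul_inv, le_div_iff₀ (by positivity)]
  rcases le_or_gt I 0 with hI0 | hI0
  · refine (mul_nonpos_of_nonpos_of_nonneg hI0 (by positivity)).trans (by positivity)
  · calc I * s ^ (2 * (β - 1)) ≤ I * (3 * m) ^ (2 * (β - 1)) := by gcongr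
      _ = ((m : ℝ) ^ (2 * (β - 1)) * I) * 3 ^ (2 * (β - 1)) := by
          rw [mul_pow]
          ring
      _ ≤ L ^ 2 * 3 ^ (2 * (β - 1)) := by gcongr

theorem tail_le_rate (hs : 1 ≤ s) (hn5 : s ^ 5 ≤ n) (hm0 : 1 ≤ m) (hms : m ≤ 3 * s) {f₀ : ℝ}
    (hf₀ : 0 < f₀) :
    (n : ℝ) ^ 4 * (2 * (m : ℝ) ^ 2 * Real.exp (-(n * (f₀ / (2 * m)) ^ 2 / 8)))
      ≤ 18 * 362880 * (288 / f₀ ^ 2) ^ 9 * (s ^ 3 / n) := by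
  have hs0 : 0 < s := by linarith
  have hn0 : (0 : ℝ) < n := lt_of_lt_of_le (by positivity) hn5
  have hm' : (0 : ℝ) < m := by exact_mod_cast hm0
  have h1 : n * f₀ ^ 2 / (288 * s ^ 2) ≤ n * (f₀ / (2 * m)) ^ 2 / 8 := by
    have : n * (f₀ / (2 * m)) ^ 2 / 8 = n * f₀ ^ 2 / (32 * (m : ℝ) ^ 2) := by
      field_simp
      ring
    rw [this]
    have h : (m : ℝ) ^ 2 ≤ (3 * s) ^ 2 := by gcongr
    exact div_le_div_of_nonneg_left (by positivity) (by positivity) (by linarith)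
  have h2 : Real.exp (-(n * (f₀ / (2 * m)) ^ 2 / 8))
      ≤ 362880 / (n * f₀ ^ 2 / (288 * s ^ 2)) ^ 9 :=
    (Real.exp_le_exp.2 (neg_le_neg h1)).trans (exp_neg_le _ (by positivity))
  have h3 : (m : ℝ) ^ 2 ≤ 9 * s ^ 2 := by
    have : (m : ℝ) ^ 2 ≤ (3 * s) ^ 2 := by gcongr
    linarith
  calc (n : ℝ) ^ 4 * (2 * (m : ℝ) ^ 2 * Real.exp (-(n * (f₀ / (2 * m)) ^ 2 / 8)))
      ≤ (n : ℝ) ^ 4 * (2 * (9 * s ^ 2) * (362880 / (n * f₀ ^ 2 / (288 * s ^ 2)) ^ 9)) := by gcongr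
    _ = 18 * 362880 * (288 / f₀ ^ 2) ^ 9 * (((s ^ 5) ^ 4) / (n : ℝ) ^ 5) := by
        field_simp
        norm_num
    _ ≤ 18 * 362880 * (288 / f₀ ^ 2) ^ 9 * ((n : ℝ) ^ 4 / (n : ℝ) ^ 5) := by gcongr
    _ = 18 * 362880 * (288 / f₀ ^ 2) ^ 9 * (1 / n) := by
        congr 1
        field_simp
    _ ≤ 18 * 362880 * (288 / f₀ ^ 2) ^ 9 * (s ^ 3 / n) := by
        gcongr
        exact one_le_pow₀ hs

theorem log_le_rate (hs : 1 ≤ s) (hn : s ^ (2 * β + 1) = n) (hms : m ≤ 3 * s) :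
    m * Real.log n / n ≤ 3 * (2 * β + 1) * (s ^ 3 / n) := by
  have hs0 : 0 < s := by linarith
  have hn0 : (0 : ℝ) < n := by
    rw [← hn]
    positivity
  have h1 : Real.log n ≤ (2 * β + 1) * s := by
    rw [← hn, Real.log_pow]
    push_cast
    gcongr
    linarith [Real.log_le_sub_one_of_pos hs0]
  rw [← mul_div_assoc]
  refine div_le_div_of_nonneg_right ?_ hn0.le
  calc m * Real.log n ≤ (3 * s) * ((2 * β + 1) * s) := by
        gcongr
    _ = 3 * (2 * β + 1) * s ^ 2 := by ring
    _ ≤ 3 * (2 * β + 1) * s ^ 3 := by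
        have : s ^ 2 ≤ s ^ 3 := pow_le_pow_right₀ hs (by norm_num)
        gcongr

theorem rate_eq (hβ : 1 < β) (hn : 1 ≤ n) :
    1 ≤ (n : ℝ) ^ (1 / (2 * (β : ℝ) + 1)) ∧
      ((n : ℝ) ^ (1 / (2 * (β : ℝ) + 1))) ^ (2 * β + 1) = n ∧
      (n : ℝ) ^ (-(2 * ((β : ℝ) - 1) / (2 * (β : ℝ) + 1)))
        = ((n : ℝ) ^ (1 / (2 * (β : ℝ) + 1))) ^ 3 / n := by
  have hn0 : (0 : ℝ) < n := by exact_mod_cast hn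
  have hb : (0 : ℝ) < 2 * β + 1 := by positivity
  refine ⟨Real.one_le_rpow (by exact_mod_cast hn) (by positivity), ?_, ?_⟩
  · rw [← Real.rpow_natCast, ← Real.rpow_mul hn0.le]
    push_cast
    rw [one_div_mul_cancel hb.ne', Real.rpow_one]
  · rw [← Real.rpow_natCast, ← Real.rpow_mul hn0.le, ← Real.rpow_sub_one hn0.ne']
    congr 1
    push_cast
    field_simp
    ring

end Rates

/-- The constant of the rate of convergence. -/
def rateConst (β : ℕ) (L f₀ f₁ σ : ℝ) : ℝ :=
  2 * f₁ * (L ^ 2 * 3 ^ (2 * (β - 1)))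
    + 128 * (f₁ + f₀) / f₀ * f₁ * (L ^ 2 * 3 ^ (2 * (β - 1)))
    + 128 * (f₁ + f₀) / f₀ * σ ^ 2 * 27
    + L ^ 2 * 2 * (1 / (f₀ / 2) + 1) / cutoffConst * (3 * (2 * β + 1))
    + 10368 * (σ ^ 2 + L ^ 2) * (18 * 362880 * (288 / f₀ ^ 2) ^ 9) + 1

end DerivReg

end

open DerivReg in
theorem mainTheorem4 (β : ℕ) (hβ : 1 < β) (L f₀ f₁ σ : ℝ)
    (hL : 0 < L) (hf₀ : 0 < f₀) (hσ : 0 ≤ σ) :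
    ∃ C : ℝ, 0 < C ∧
      ∀ (Ω : Type*) [MeasurableSpace Ω] (μ : Measure Ω) [IsProbabilityMeasure μ]
        (n : ℕ) (_ : 1 ≤ n) (X ε : Fin n → Ω → ℝ) (f b : ℝ → ℝ),
        -- the design: i.i.d. with a density which is bounded above and below on `[0,1]`
        (∀ i, Measurable (X i)) → iIndepFun X μ →
        Measurable f → (∀ x, 0 ≤ f x) →
        (∀ i, μ.map (X i) = volume.withDensity fun x => ENNReal.ofReal (f x)) →
        (∀ x ∈ Icc (0 : ℝ) 1, f₀ ≤ f x ∧ f x ≤ f₁) →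
        -- the errors: i.i.d., centred, of variance `σ²`, independent of the design
        (∀ i, Measurable (ε i)) → iIndepFun ε μ →
        (∀ i j, IdentDistrib (ε i) (ε j) μ μ) →
        (∀ i, MemLp (ε i) 2 μ) → (∀ i, ∫ ω, ε i ω ∂μ = 0) →
        (∀ i, variance (ε i) μ = σ ^ 2) →
        IndepFun (fun ω i => X i ω) (fun ω i => ε i ω) μ →
        -- the regression function, and the moment conditions
        b ∈ DerivReg.PerSobolev β L →
        (∀ i, MemLp (fun ω => derivWithin b (Icc 0 1) (X i ω)) 4 μ) →
        (∀ i, MemLp (fun ω => b (X i ω) + ε i ω) 4 μ) →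
        -- the dimension: `n^{1/(2β+1)}` rounded, up or down, to an odd integer
        ∀ m : ℕ, Odd m → |(m : ℝ) - (n : ℝ) ^ (1 / (2 * (β : ℝ) + 1))| < 2 →
          Integrable (fun ω => DerivReg.empNormSq (fun i => X i ω) fun t =>
            DerivReg.truncEstimator m (fun i => X i ω) (fun i => b (X i ω) + ε i ω) t
              - derivWithin b (Icc 0 1) t) μ ∧
          ∫ ω, DerivReg.empNormSq (fun i => X i ω) (fun t =>
            DerivReg.truncEstimator m (fun i => X i ω) (fun i => b (X i ω) + ε i ω) t
              - derivWithin b (Icc 0 1) t) ∂μ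
            ≤ C * (n : ℝ) ^ (-(2 * ((β : ℝ) - 1) / (2 * (β : ℝ) + 1))) := by
  by_cases hf₁ : 0 ≤ f₁
  swap
  · refine ⟨1, one_pos, ?_⟩
    intro Ω _ μ _ n hn X ε f b hX hXi hf hf0 hρ hf01
    exact absurd ((hf₀.le.trans (hf01 0 (by simp)).1).trans (hf01 0 (by simp)).2) hf₁
  have hcut := cutoffConst_pos
  refine ⟨rateConst β L f₀ f₁ σ, by unfold rateConst; positivity, ?_⟩
  intro Ω _ μ _ n hn X ε f b hX hXi hf hf0 hρ hf01 hε hεi _ hε2 hε0 hεv hXε hb _ _ m hm hmn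
  obtain ⟨hs1, hsn, hrate⟩ := rate_eq hβ hn
  rw [hrate]
  set s := (n : ℝ) ^ (1 / (2 * (β : ℝ) + 1)) with hs
  have hs0 : 0 < s := by linarith
  have hm1 : 1 ≤ m := hm.pos
  have hm1' : (1 : ℝ) ≤ m := by exact_mod_cast hm1
  have hn1' : (1 : ℝ) ≤ n := by exact_mod_cast hn
  have hn0' : (0 : ℝ) < n := by linarith
  obtain ⟨hlo, hhi⟩ := abs_lt.1 hmn
  have hms : (m : ℝ) ≤ 3 * s := by linarith
  have hsm : s ≤ 3 * m := by linarith
  have hn5 : s ^ 5 ≤ n := by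
    rw [← hsn]
    exact pow_le_pow_right₀ hs1 (by omega)
  have hsn1 : s ≤ n := by
    rw [← hsn]
    exact le_self_pow₀ hs1 (by omega)
  have hm3n : m ≤ 3 * n := by
    have : (m : ℝ) ≤ 3 * n := by linarith
    exact_mod_cast this
  have hnm : n = 1 → m = 1 := by
    intro h
    have h1 : s = 1 := by
      rw [hs, h]
      simp
    have h2 : m < 3 := by
      have : (m : ℝ) < 3 := by linarith
      exact_mod_cast this
    obtain ⟨r, hr⟩ := hm
    omega
  have hprob : IsProbabilityMeasure (densityLaw f) := by
    have := Measure.isProbabilityMeasure_map (μ := μ) (hX ⟨0, hn⟩).aemeasurable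
    rwa [hρ ⟨0, hn⟩] at this
  obtain ⟨a, ha0, ha1, hasup⟩ := PerSobolev.exists_approx hβ hb hm
  have hp := PerSobolev.perContDiff hb
  have hcb : ContinuousOn b (Icc 0 1) := hp.continuousOn
  have hcb' : ContinuousOn (derivWithin b (Icc 0 1)) (Icc 0 1) := by
    obtain ⟨r, rfl⟩ : ∃ r, β = r + 1 := ⟨β - 1, by omega⟩
    exact hp.derivWithin.continuousOn
  have hXm : Measurable fun ω i => X i ω := measurable_pi_lambda _ hX
  have hεm : Measurable fun ω i => ε i ω := measurable_pi_lambda _ hε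
  have := Measure.isProbabilityMeasure_map (μ := μ) hεm.aemeasurable
  obtain ⟨hBi, hBl⟩ := integral_designBound_le (m := m) hn hX hXi hf hf0 hρ hf₀ hf₁ hf01
    (hcb.sub (continuous_trigSum m a).continuousOn)
    (hcb'.sub (continuous_trigSum m ((derivMatrix m)ᵀ *ᵥ a)).continuousOn) σ L
    (show 0 ≤ f₀ / (2 * m) by positivity)
  have main := integral_le_of_lintegral_noise_le hXm hεm hXε
    (measurable_error (m := m) measurable_fst measurable_snd hcb hcb')
    (fun p => empNormSq_nonneg _ _) (fun x => designBound_nonneg hf₀ hf₁ _ _ _ x)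
    (fun x => (whiteNoise_map hε hεi hε2 hε0 hεv).lintegral_error_le hn hm1 hm3n hnm hf₀ hf₁
      (fun x hx => GramClose.gramBounds hf hf0 hf₀ hf01 hm1 hx)
      (fun t ht => PerSobolev.derivWithin_sq_le hβ hb ht) hasup x) hBi
  refine ⟨main.1, main.2.trans (hBl.trans ?_)⟩
  simp only [Pi.sub_apply]
  have r1 := inv_pow_le_rate hβ hs1 hsn hsm ha1
  have r0 : (m : ℝ) ^ 2 * ∫ x in (0 : ℝ)..1, (b x - trigSum m a x) ^ 2
      ≤ L ^ 2 * 3 ^ (2 * (β - 1)) * (s ^ 3 / n) := by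
    refine inv_pow_le_rate hβ hs1 hsn hsm (le_trans (le_of_eq ?_) ha0)
    rw [← mul_assoc, ← pow_add]
    congr 2
    omega
  have rv : (m : ℝ) ^ 2 * (m / n) ≤ 27 * (s ^ 3 / n) := by
    have : (m : ℝ) ^ 3 ≤ (3 * s) ^ 3 := by gcongr
    calc (m : ℝ) ^ 2 * (m / n) = (m : ℝ) ^ 3 / n := by ring
      _ ≤ (3 * s) ^ 3 / n := by gcongr
      _ = 27 * (s ^ 3 / n) := by ring
  have rl := log_le_rate hs1 hsn hms
  have rt := tail_le_rate hs1 hn5 hm1 hms hf₀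
  set R := s ^ 3 / (n : ℝ) with hR
  have hR0 : 0 ≤ R := by positivity
  set I1 := ∫ x in (0 : ℝ)..1, (derivWithin b (Icc 0 1) x
    - trigSum m ((derivMatrix m)ᵀ *ᵥ a) x) ^ 2
  set I0 := ∫ x in (0 : ℝ)..1, (b x - trigSum m a x) ^ 2
  have t1 := mul_le_mul_of_nonneg_left r1 (show 0 ≤ 2 * f₁ by positivity)
  have t0 := mul_le_mul_of_nonneg_left r0
    (show 0 ≤ 128 * (f₁ + f₀) / f₀ * f₁ by positivity)
  have tv := mul_le_mul_of_nonneg_left rv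
    (show 0 ≤ 128 * (f₁ + f₀) / f₀ * σ ^ 2 by positivity)
  have tl := mul_le_mul_of_nonneg_left rl
    (show 0 ≤ L ^ 2 * 2 * (1 / (f₀ / 2) + 1) / cutoffConst by positivity)
  have tt := mul_le_mul_of_nonneg_left rt
    (show 0 ≤ 10368 * (σ ^ 2 + L ^ 2) by positivity)
  have el : L ^ 2 * (2 * m * (1 / (f₀ / 2) + 1) * Real.log n / (cutoffConst * n))
      = L ^ 2 * 2 * (1 / (f₀ / 2) + 1) / cutoffConst * (m * Real.log n / n) := by
    field_simp
  rw [el]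
  unfold rateConst
  linarith
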